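/- Let $k$ be a field, regarded as a discrete topological ring. A \emph{pseudocompact} $k$-algebra is an associative unital topological $k$-algebra that is Hausdorff and complete and has a basis of neighbourhoods of $0$ consisting of open two-sided ideals of finite codimension. For topological $k$-algebras $A,B$ of this kind, $A\hat\otimes_k B=\varprojlim_{I,J} A/I\otimes_k B/J$ denotes the completed tensor product, $I$ and $J$ running over the open two-sided ideals of $A$ and $B$ and each $A/I\otimes_k B/J$ being discrete. A \emph{pseudocompact $A$-bimodule} is a topological $A$-bimodule $T$ (with continuous actions, on which the two actions of $k$ agree) that is Hausdorff and complete and has a basis of neighbourhoods of $0$ consisting of open sub-bimodules of finite codimension; equivalently, an inverse limit of discrete finite-dimensional topological $A$-bimodules. Homomorphisms of such bimodules are the continuous bimodule homomorphisms. $A\hat\otimes_k A$ is an $A$-bimodule via $a\cdot(b\hat\otimes c)=ab\hat\otimes c$ and $(b\hat\otimes c)\cdot a=b\hat\otimes ca$, and $m:A\hat\otimes_k A\to A$ is the continuous bimodule homomorphism with $m(b\hat\otimes c)=bc$. A topological algebra is (topologically) \emph{semisimple} if each closed left ideal has a closed left ideal as a complement. A pseudocompact algebra $A$ is \emph{separable}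 if $A\hat\otimes_k E$ is semisimple for every finite field extension $E$ of $k$ (with $E$ discrete). A \emph{pseudocompact derivation} of $A$ is a continuous $k$-linear map $d:A\to T$ into a pseudocompact $A$-bimodule with $d(ab)=a\,d(b)+d(a)\,b$; it is \emph{inner} if there is $u\in T$ with $d(a)=ua-au$ for all $a\in A$. \textbf{Theorem.} Let $A$ be a pseudocompact algebra over a field $k$. The following are equivalent: \begin{enumerate} \item $A$ is separable; \item $A$ is isomorphic, as a topological algebra, to a product $\prod_i M_{n_i}(\Delta_i)$ (with the product topology, each factor being discrete), where each $n_i\ge 1$ and each $\Delta_i$ is a finite-dimensional division $k$-algebra whose centre is a separable field extension of $k$; \item $A$ is isomorphic, as a topological algebra, to the inverse limit of a directed inverse system of discrete finite-dimensional separable $k$-algebras and $k$-algebra homomorphisms; \item $A$ is projective as an $A$-bimodule, i.e.\ for every surjective homomorphism $f:M\to N$ of pseudocompact $A$-bimodules, every homomorphism $A\to N$ lifts along $f$ to a homomorphism $A\to M$; \item there is a continuous $A$-bimodule homomorphism $\gamma:A\to A\hat\otimes_k A$ with $m\gamma=\mathrm{id}_A$; \item $A$ has a separability idempotent: an element $p\in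 A\hat\otimes_k A$ with $m(p)=1$ and $ap=pa$ for all $a\in A$; \item every pseudocompact derivation $d:A\to T$, for every pseudocompact $A$-bimodule $T$, is inner; \item the universal derivation $f:A\to\operatorname{Ker}(m)$, $f(a)=1\hat\otimes a-a\hat\otimes 1$, is inner, i.e.\ there is $u\in\operatorname{Ker}(m)$ with $f(a)=ua-au$ for all $a\in A$. \end{enumerate} -/

import Mathlib

open Topology Filter TensorProduct MulOpposite

universe u v

/-! ### Pseudocompact algebras -/

/-- A topological `k`-algebra `A` (with `k` a discrete field) is pseudocompact if it is Hausdorff,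
complete, and has a basis of neighbourhoods of `0` consisting of open two-sided ideals of finite
codimension. Continuity of `k × A → A` for discrete `k` follows from that of the product. -/
class IsPseudocompactAlgebra (k : Type v) (A : Type u) [Field k] [Ring A] [Algebra k A]
    [TopologicalSpace A] : Prop where
  isTopologicalRing : IsTopologicalRing A
  t2Space : T2Space A
  completeSpace : letI := IsTopologicalAddGroup.rightUniformSpace A; CompleteSpace A
  hasBasis : (𝓝 (0 : A)).HasBasis
    (fun I : Ideal A => I.IsTwoSided ∧ IsOpen (I : Set A) ∧
      FiniteDimensional k (A ⧸ I.restrictScalars k))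
    (fun I => (I : Set A))

/-- `A` is (left) topologically semisimple: every closed left ideal has a closed complement. -/
def IsTopologicallySemisimple (A : Type*) [Ring A] [TopologicalSpace A] : Prop :=
  ∀ I : Ideal A, IsClosed (I : Set A) →
    ∃ L : Ideal A, IsClosed (L : Set A) ∧ IsCompl I L

/-! ### Inverse limits of discrete algebras -/

section InverseLimit

variable {k : Type*} [Field k] {ι : Type*} [Preorder ι] {B : ι → Type*} [∀ i, Ring (B i)]
  [∀ i, Algebra k (B i)]

/-- Compatible families in `∏ i, B i`. -/
def compatibleFamilies (φ : ∀ ⦃i j : ι⦄, i ≤ j → B j →ₐ[k] B i) : Subalgebra k (∀ i, B i) where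
  carrier := {x | ∀ ⦃i j : ι⦄ (h : i ≤ j), φ h (x j) = x i}
  mul_mem' hx hy i j h := by simp [hx h, hy h]
  add_mem' hx hy i j h := by simp [hx h, hy h]
  algebraMap_mem' r i j h := by simp

/-- The inverse limit of an inverse system of algebras `B i`, each regarded as discrete. -/
def InverseLimit (φ : ∀ ⦃i j : ι⦄, i ≤ j → B j →ₐ[k] B i) : Type _ :=
  ↥(compatibleFamilies φ)

namespace InverseLimit

variable (φ : ∀ ⦃i j : ι⦄, i ≤ j → B j →ₐ[k] B i)

instance : Ring (InverseLimit φ) := inferInstanceAs (Ring ↥(compatibleFamilies φ))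

instance : Algebra k (InverseLimit φ) := inferInstanceAs (Algebra k ↥(compatibleFamilies φ))

/-- The projection to the `i`-th term. -/
def proj (i : ι) : InverseLimit φ →ₐ[k] B i :=
  (Pi.evalAlgHom k B i).comp (compatibleFamilies φ).val

/-- The coarsest topology for which all projections to the discrete `B i` are continuous, i.e. the
topology induced by the product of the discrete topologies. -/
instance : TopologicalSpace (InverseLimit φ) :=
  ⨅ i, TopologicalSpace.induced (proj φ i) ⊥

variable {φ}

theorem ext {x y : InverseLimit φ} (h : ∀ i, proj φ i x = proj φ i y) : x = y :=
  Subtype.ext (funext h)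

theorem proj_compat (x : InverseLimit φ) {i j : ι} (h : i ≤ j) :
    φ h (proj φ j x) = proj φ i x := x.2 h

variable (φ) in
/-- The algebra homomorphism into the inverse limit given by a compatible family. -/
def lift {C : Type*} [Ring C] [Algebra k C] (f : ∀ i, C →ₐ[k] B i)
    (hf : ∀ ⦃i j : ι⦄ (h : i ≤ j) (c : C), φ h (f j c) = f i c) : C →ₐ[k] InverseLimit φ :=
  (AlgHom.pi f).codRestrict (compatibleFamilies φ) (fun c _ _ h => hf h c)

@[simp]
theorem proj_lift {C : Type*} [Ring C] [Algebra k C] (f : ∀ i, C →ₐ[k] B i)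
    (hf : ∀ ⦃i j : ι⦄ (h : i ≤ j) (c : C), φ h (f j c) = f i c) (c : C) (i : ι) :
    proj φ i (lift φ f hf c) = f i c := rfl

variable (φ) in
theorem isOpen_preimage_proj (i : ι) (s : Set (B i)) : IsOpen (proj φ i ⁻¹' s) := by
  have h : (⨅ j, TopologicalSpace.induced (proj φ j) ⊥ : TopologicalSpace (InverseLimit φ)) ≤
    TopologicalSpace.induced (proj φ i) ⊥ := iInf_le _ i
  exact h _ ⟨s, trivial, rfl⟩

theorem continuous_iff {X : Type*} [TopologicalSpace X] {f : X → InverseLimit φ} :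
    Continuous f ↔ ∀ i (b : B i), IsOpen ((fun x => proj φ i (f x)) ⁻¹' {b}) := by
  refine continuous_iInf_rng.trans (forall_congr' fun i => ?_)
  rw [continuous_induced_rng]
  let : TopologicalSpace (B i) := ⊥
  have : DiscreteTopology (B i) := ⟨rfl⟩
  exact continuous_discrete_rng

instance : IsTopologicalAddGroup (InverseLimit φ) :=
  topologicalAddGroup_iInf fun i => by
    let : TopologicalSpace (B i) := ⊥
    have : DiscreteTopology (B i) := ⟨rfl⟩
    exact topologicalAddGroup_induced (proj φ i)

end InverseLimit

end InverseLimit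

/-! ### Completed tensor products -/

/-- Open two-sided ideals of `A`. -/
structure OpenIdeal (A : Type*) [Ring A] [TopologicalSpace A] where
  ideal : Ideal A
  isTwoSided : ideal.IsTwoSided
  isOpen : IsOpen (ideal : Set A)

namespace OpenIdeal

variable {A : Type*} [Ring A] [TopologicalSpace A]

instance (I : OpenIdeal A) : I.ideal.IsTwoSided := I.isTwoSided

/-- Reverse inclusion, so that `i ≤ j` gives a projection `A ⧸ j → A ⧸ i`. -/
instance : Preorder (OpenIdeal A) where
  le I J := J.ideal ≤ I.ideal
  le_refl _ := le_rfl
  le_trans _ _ _ h h' := h'.trans h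

end OpenIdeal

section CompletedTensor

variable (k : Type*) (A B : Type*) [Field k] [Ring A] [Algebra k A] [TopologicalSpace A]
  [Ring B] [Algebra k B] [TopologicalSpace B]

/-- The transition maps `A ⧸ I' ⊗ B ⧸ J' → A ⧸ I ⊗ B ⧸ J` for `I' ≤ I`, `J' ≤ J`. -/
noncomputable def quotientTensorMap ⦃p q : OpenIdeal A × OpenIdeal B⦄ (h : p ≤ q) :
    (A ⧸ q.1.ideal) ⊗[k] (B ⧸ q.2.ideal) →ₐ[k] (A ⧸ p.1.ideal) ⊗[k] (B ⧸ p.2.ideal) :=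
  Algebra.TensorProduct.map (Ideal.Quotient.factorₐ k h.1) (Ideal.Quotient.factorₐ k h.2)

/-- The completed tensor product of `A` and `B` over `k`: the inverse limit of the discrete algebras
`A ⧸ I ⊗ B ⧸ J`, over the open two-sided ideals `I` of `A` and `J` of `B`. -/
abbrev CompletedTensor : Type _ := InverseLimit (quotientTensorMap k A B)

namespace CompletedTensor

/-- `a ↦ a ⊗ 1`. -/
noncomputable def inl : A →ₐ[k] CompletedTensor k A B :=
  InverseLimit.lift (quotientTensorMap k A B)
    (fun p => Algebra.TensorProduct.includeLeft.comp (Ideal.Quotient.mkₐ k p.1.ideal))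
    (fun p q h a => by simp [quotientTensorMap])

/-- `b ↦ 1 ⊗ b`. -/
noncomputable def inr : B →ₐ[k] CompletedTensor k A B :=
  InverseLimit.lift (quotientTensorMap k A B)
    (fun p => Algebra.TensorProduct.includeRight.comp (Ideal.Quotient.mkₐ k p.2.ideal))
    (fun p q h a => by simp [quotientTensorMap])

variable {k A B}

theorem proj_inl (a : A) (p : OpenIdeal A × OpenIdeal B) :
    InverseLimit.proj (quotientTensorMap k A B) p (inl k A B a) =
      (Ideal.Quotient.mk p.1.ideal a) ⊗ₜ 1 := rfl

theorem proj_inr (b : B) (p : OpenIdeal A × OpenIdeal B) :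
    InverseLimit.proj (quotientTensorMap k A B) p (inr k A B b) =
      1 ⊗ₜ (Ideal.Quotient.mk p.2.ideal b) := rfl

variable (k A B)

/-- The left action of `A`, determined by `a • (b ⊗ c) = ab ⊗ c`. -/
noncomputable instance : Module A (CompletedTensor k A B) :=
  Module.compHom _ (inl k A B).toRingHom

/-- The right action of `B`, determined by `(b ⊗ c) · a = b ⊗ ca`. -/
noncomputable instance : Module Bᵐᵒᵖ (CompletedTensor k A B) where
  smul r x := x * inr k A B r.unop
  one_smul x := by change x * _ = x; simp
  mul_smul r s x := by change x * _ = x * _ * _; simp [mul_assoc]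
  smul_zero r := by change 0 * _ = _; simp
  smul_add r x y := by change (x + y) * _ = _; rw [add_mul]; rfl
  add_smul r s x := by change x * _ = _; rw [unop_add, map_add, mul_add]; rfl
  zero_smul x := by change x * _ = _; simp

variable {k A B}

theorem smul_def (a : A) (x : CompletedTensor k A B) : a • x = inl k A B a * x := rfl

theorem op_smul_def (b : B) (x : CompletedTensor k A B) : op b • x = x * inr k A B b := rfl

instance : SMulCommClass A Bᵐᵒᵖ (CompletedTensor k A B) :=
  ⟨fun a r x => (mul_assoc (inl k A B a) x (inr k A B r.unop)).symm⟩

instance : IsScalarTower k A (CompletedTensor k A B) :=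
  ⟨fun c a x => by rw [smul_def, smul_def, map_smul, smul_mul_assoc]⟩

instance : IsScalarTower k Bᵐᵒᵖ (CompletedTensor k A B) :=
  ⟨fun c r x => by
    change x * inr k A B (c • r).unop = c • (x * inr k A B r.unop)
    rw [unop_smul, map_smul, mul_smul_comm]⟩

end CompletedTensor

/-- `A` is separable over `k`: for every finite field extension `E` of `k` (with the discrete
topology), the completed tensor product of `A` and `E` is topologically semisimple. -/
def IsSeparableAlgebra (k : Type v) (A : Type u) [Field k] [Ring A] [Algebra k A]
    [TopologicalSpace A] : Prop :=
  ∀ (E : Type v) [Field E] [Algebra k E] [FiniteDimensional k E]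
    [TopologicalSpace E] [DiscreteTopology E],
    IsTopologicallySemisimple (CompletedTensor k A E)

end CompletedTensor

/-! ### Pseudocompact bimodules and derivations -/

section Bimodule

/-- A topological `A`-bimodule `T` (on which the two actions of `k` agree) is pseudocompact if it is
Hausdorff, complete, has continuous actions, and has a basis of neighbourhoods of `0` consisting of
open sub-bimodules of finite codimension; equivalently, `T` is an inverse limit of discrete
finite-dimensional topological `A`-bimodules. The right action of `a` is that of `op a`. -/
structure IsPseudocompactBimodule (k : Type*) (A T : Type*) [Field k] [Ring A] [Algebra k A]
    [TopologicalSpace A] [AddCommGroup T] [Module k T] [Module A T] [Module Aᵐᵒᵖ T]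
    [IsScalarTower k A T] [IsScalarTower k Aᵐᵒᵖ T] [SMulCommClass A Aᵐᵒᵖ T]
    [TopologicalSpace T] : Prop where
  isTopologicalAddGroup : IsTopologicalAddGroup T
  continuousSMul_left : ContinuousSMul A T
  continuousSMul_right : ContinuousSMul Aᵐᵒᵖ T
  t2Space : T2Space T
  completeSpace : letI := IsTopologicalAddGroup.rightUniformSpace T; CompleteSpace T
  hasBasis : (𝓝 (0 : T)).HasBasis
    (fun N : Submodule k T => IsOpen (N : Set T) ∧ (∀ a : A, ∀ x ∈ N, a • x ∈ N) ∧
      (∀ a : A, ∀ x ∈ N, op a • x ∈ N) ∧ FiniteDimensional k (T ⧸ N))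
    (fun N => (N : Set T))

/-- `f` commutes with the left and right actions of `A`. -/
def IsBimoduleHom {k : Type*} (A : Type*) {M N : Type*} [Field k] [Ring A]
    [AddCommGroup M] [Module k M] [Module A M] [Module Aᵐᵒᵖ M] [TopologicalSpace M]
    [AddCommGroup N] [Module k N] [Module A N] [Module Aᵐᵒᵖ N] [TopologicalSpace N]
    (f : M →L[k] N) : Prop :=
  (∀ (a : A) (x : M), f (a • x) = a • f x) ∧ (∀ (a : A) (x : M), f (op a • x) = op a • f x)

/-- `P` is a projective object among the pseudocompact `A`-bimodules: continuous bimodule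
homomorphisms from `P` lift along surjective ones. -/
def IsProjectiveBimodule (k : Type v) (A P : Type u) [Field k] [Ring A] [Algebra k A]
    [TopologicalSpace A] [AddCommGroup P] [Module k P] [Module A P] [Module Aᵐᵒᵖ P]
    [TopologicalSpace P] : Prop :=
  ∀ (M N : Type u)
    [AddCommGroup M] [Module k M] [Module A M] [Module Aᵐᵒᵖ M] [IsScalarTower k A M]
    [IsScalarTower k Aᵐᵒᵖ M] [SMulCommClass A Aᵐᵒᵖ M] [TopologicalSpace M]
    [AddCommGroup N] [Module k N] [Module A N] [Module Aᵐᵒᵖ N] [IsScalarTower k A N]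
    [IsScalarTower k Aᵐᵒᵖ N] [SMulCommClass A Aᵐᵒᵖ N] [TopologicalSpace N],
    IsPseudocompactBimodule k A M → IsPseudocompactBimodule k A N →
    ∀ (f : M →L[k] N) (g : P →L[k] N), IsBimoduleHom A f → IsBimoduleHom A g →
      Function.Surjective f →
      ∃ h : P →L[k] M, IsBimoduleHom A h ∧ ∀ x, f (h x) = g x

variable {k : Type*} {A T : Type*} [Field k] [Ring A] [Algebra k A] [TopologicalSpace A]
  [AddCommGroup T] [Module k T] [Module A T] [Module Aᵐᵒᵖ T] [TopologicalSpace T]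

/-- The Leibniz rule `d (ab) = a d(b) + d(a) b`. -/
def IsDerivation (d : A →L[k] T) : Prop :=
  ∀ a b : A, d (a * b) = a • d b + op b • d a

/-- `d` is inner: `d a = ua - au` for a fixed `u`. -/
def IsInnerDerivation (d : A →L[k] T) : Prop :=
  ∃ u : T, ∀ a : A, d a = op a • u - a • u

/-- Every pseudocompact derivation of `A` is inner. -/
def EveryDerivationInner (k : Type v) (A : Type u) [Field k] [Ring A] [Algebra k A]
    [TopologicalSpace A] : Prop :=
  ∀ (T : Type u) [AddCommGroup T] [Module k T] [Module A T] [Module Aᵐᵒᵖ T] [IsScalarTower k A T]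
    [IsScalarTower k Aᵐᵒᵖ T] [SMulCommClass A Aᵐᵒᵖ T] [TopologicalSpace T],
    IsPseudocompactBimodule k A T →
    ∀ d : A →L[k] T, IsDerivation d → IsInnerDerivation d

end Bimodule

/-! ### The multiplication map of a pseudocompact algebra -/

section Multiplication

variable (k : Type*) (A : Type*) [Field k] [Ring A] [Algebra k A] [TopologicalSpace A]

namespace IsPseudocompactAlgebra

theorem exists_openIdeal [hA : IsPseudocompactAlgebra k A] {s : Set A} (hs : s ∈ 𝓝 (0 : A)) :
    ∃ I : OpenIdeal A, (I.ideal : Set A) ⊆ s := by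
  obtain ⟨I, ⟨h1, h2, -⟩, h⟩ := hA.hasBasis.mem_iff.1 hs
  exact ⟨⟨I, h1, h2⟩, h⟩

/-- Elements with the same image in all `A ⧸ I` are equal. -/
theorem eq_of_mk_eq [hA : IsPseudocompactAlgebra k A] {a b : A}
    (h : ∀ I : OpenIdeal A, Ideal.Quotient.mk I.ideal a = Ideal.Quotient.mk I.ideal b) : a = b := by
  have := hA.t2Space
  by_contra hne
  have : ({a - b}ᶜ : Set A) ∈ 𝓝 (0 : A) :=
    isOpen_compl_singleton.mem_nhds (fun h0 => hne (sub_eq_zero.1 (Eq.symm h0)))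
  obtain ⟨I, hI⟩ := exists_openIdeal k A this
  exact hI (Ideal.Quotient.eq.1 (h I)) rfl

/-- Compatible families in the `A ⧸ I` come from elements of `A`. -/
theorem exists_mk_eq [hA : IsPseudocompactAlgebra k A] (b : ∀ I : OpenIdeal A, A ⧸ I.ideal)
    (hb : ∀ ⦃I J : OpenIdeal A⦄ (h : I ≤ J), Ideal.Quotient.factor h (b J) = b I) :
    ∃ a : A, ∀ I, Ideal.Quotient.mk I.ideal a = b I := by
  have := hA.isTopologicalRing
  let := IsTopologicalAddGroup.rightUniformSpace A
  have : CompleteSpace A := hA.completeSpace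
  choose c hc using fun I => Ideal.Quotient.mk_surjective (b I)
  have hcc : ∀ ⦃I J : OpenIdeal A⦄, I ≤ J → c J - c I ∈ I.ideal := fun I J h => by
    rw [← Ideal.Quotient.eq, hc I, ← hb h, ← hc J, Ideal.Quotient.factor_mk]
  have : Nonempty (OpenIdeal A) := ⟨⟨⊤, inferInstance, isOpen_univ⟩⟩
  have : IsDirectedOrder (OpenIdeal A) := ⟨fun I J =>
    ⟨⟨I.ideal ⊓ J.ideal,
      ⟨fun b h => ⟨I.ideal.mul_mem_right b h.1, J.ideal.mul_mem_right b h.2⟩⟩,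
      I.isOpen.inter J.isOpen⟩,
      (inf_le_left : I.ideal ⊓ J.ideal ≤ I.ideal), (inf_le_right : I.ideal ⊓ J.ideal ≤ J.ideal)⟩⟩
  have hC : Cauchy (map c atTop) := by
    rw [cauchy_map_iff]
    refine ⟨inferInstance, ?_⟩
    rw [uniformity_eq_comap_nhds_zero', tendsto_comap_iff]
    intro s hs
    obtain ⟨I, hI⟩ := exists_openIdeal k A hs
    have h1 := prod_mem_prod (mem_atTop I) (mem_atTop I)
    rw [mem_map]
    refine mem_of_superset h1 ?_
    rintro ⟨J, K⟩ ⟨hJ, hK⟩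
    refine hI ?_
    have := I.ideal.sub_mem (hcc hK) (hcc hJ)
    simpa [sub_eq_add_neg] using this
  obtain ⟨a, ha⟩ := CompleteSpace.complete hC
  refine ⟨a, fun I => ?_⟩
  have hn : (fun x => x - a) ⁻¹' (I.ideal : Set A) ∈ 𝓝 a := by
    refine (I.isOpen.preimage (by fun_prop)).mem_nhds ?_
    simp
  obtain ⟨J, hJ⟩ := mem_atTop_sets.1 (ha hn)
  obtain ⟨K, hIK, hJK⟩ := exists_ge_ge I J
  have h1 : c K - a ∈ I.ideal := hJ K hJK
  have h2 := hcc hIK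
  rw [← hc I, Ideal.Quotient.eq]
  have := I.ideal.sub_mem h2 h1
  simpa using this

end IsPseudocompactAlgebra

variable {A} in
/-- The component `A ⧸ I ⊗ A ⧸ I → A ⧸ I` of the multiplication map. -/
noncomputable def mulComponent (I : OpenIdeal A) : CompletedTensor k A A →ₗ[k] A ⧸ I.ideal :=
  (LinearMap.mul' k (A ⧸ I.ideal)) ∘ₗ
    (InverseLimit.proj (quotientTensorMap k A A) (I, I)).toLinearMap

variable {k A}

theorem mulComponent_compat (x : CompletedTensor k A A) ⦃I J : OpenIdeal A⦄ (h : I ≤ J) :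
    Ideal.Quotient.factor h (mulComponent k J x) = mulComponent k I x := by
  have h2 : ((I, I) : OpenIdeal A × OpenIdeal A) ≤ (J, J) := ⟨h, h⟩
  simp only [mulComponent, LinearMap.comp_apply, AlgHom.toLinearMap_apply]
  rw [← InverseLimit.proj_compat x h2]
  generalize InverseLimit.proj (quotientTensorMap k A A) (J, J) x = t
  induction t using TensorProduct.induction_on with
  | zero => simp
  | tmul a b => simp [quotientTensorMap]
  | add a b ha hb => simp only [map_add, ha, hb]

theorem mulComponent_smul (I : OpenIdeal A) (a : A) (x : CompletedTensor k A A) :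
    mulComponent k I (a • x) = Ideal.Quotient.mk I.ideal a * mulComponent k I x := by
  simp only [mulComponent, LinearMap.comp_apply, AlgHom.toLinearMap_apply,
    CompletedTensor.smul_def, map_mul]
  change LinearMap.mul' k (A ⧸ I.ideal) ((Ideal.Quotient.mk I.ideal a ⊗ₜ 1) * _) = _
  generalize InverseLimit.proj (quotientTensorMap k A A) (I, I) x = t
  induction t using TensorProduct.induction_on with
  | zero => simp
  | tmul b c => simp [mul_assoc]
  | add b c hb hc => simp only [map_add, mul_add, hb, hc]

theorem mulComponent_op_smul (I : OpenIdeal A) (a : A) (x : CompletedTensor k A A) :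
    mulComponent k I (op a • x) = mulComponent k I x * Ideal.Quotient.mk I.ideal a := by
  simp only [mulComponent, LinearMap.comp_apply, AlgHom.toLinearMap_apply,
    CompletedTensor.op_smul_def, map_mul]
  change LinearMap.mul' k (A ⧸ I.ideal) (_ * (1 ⊗ₜ Ideal.Quotient.mk I.ideal a)) = _
  generalize InverseLimit.proj (quotientTensorMap k A A) (I, I) x = t
  induction t using TensorProduct.induction_on with
  | zero => simp
  | tmul b c => simp [mul_assoc]
  | add b c hb hc => simp only [map_add, add_mul, hb, hc]

variable (k A) [hA : IsPseudocompactAlgebra k A]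

/-- The underlying function of the multiplication map: `m x` is the unique element of `A` whose
image in each `A ⧸ I` is the product of the component of `x` in `A ⧸ I ⊗ A ⧸ I`. -/
noncomputable def mulMapFun (x : CompletedTensor k A A) : A :=
  (IsPseudocompactAlgebra.exists_mk_eq k A (fun I => mulComponent k I x)
    (mulComponent_compat x)).choose

theorem mk_mulMapFun (x : CompletedTensor k A A) (I : OpenIdeal A) :
    Ideal.Quotient.mk I.ideal (mulMapFun k A x) = mulComponent k I x :=
  (IsPseudocompactAlgebra.exists_mk_eq k A (fun I => mulComponent k I x)
    (mulComponent_compat x)).choose_spec I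

/-- The multiplication map, the continuous linear map with `b ⊗ c ↦ bc`. -/
noncomputable def mulMap : CompletedTensor k A A →L[k] A where
  toFun := mulMapFun k A
  map_add' x y := IsPseudocompactAlgebra.eq_of_mk_eq k A fun I => by
    simp only [map_add, mk_mulMapFun]
  map_smul' c x := IsPseudocompactAlgebra.eq_of_mk_eq k A fun I => by
    rw [mk_mulMapFun, map_smul, RingHom.id_apply, ← mk_mulMapFun]
    exact (map_smul (Ideal.Quotient.mkₐ k I.ideal) c _).symm
  cont := by
    have := hA.isTopologicalRing
    let f : CompletedTensor k A A →+ A :=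
      { toFun := mulMapFun k A
        map_zero' := IsPseudocompactAlgebra.eq_of_mk_eq k A fun I => by
          simp only [map_zero, mk_mulMapFun]
        map_add' := fun x y => IsPseudocompactAlgebra.eq_of_mk_eq k A fun I => by
          simp only [map_add, mk_mulMapFun] }
    refine continuous_of_continuousAt_zero f ?_
    intro s hs
    rw [map_zero] at hs
    obtain ⟨I, hI⟩ := IsPseudocompactAlgebra.exists_openIdeal k A hs
    rw [mem_map]
    refine mem_of_superset ((InverseLimit.isOpen_preimage_proj (quotientTensorMap k A A) (I, I)
      {0}).mem_nhds (map_zero _)) fun x hx => hI ?_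
    have hx' : InverseLimit.proj (quotientTensorMap k A A) (I, I) x = 0 := hx
    change mulMapFun k A x ∈ I.ideal
    rw [← Ideal.Quotient.eq_zero_iff_mem, mk_mulMapFun, mulComponent, LinearMap.comp_apply,
      AlgHom.toLinearMap_apply, hx', map_zero]

theorem mk_mulMap (x : CompletedTensor k A A) (I : OpenIdeal A) :
    Ideal.Quotient.mk I.ideal (mulMap k A x) = mulComponent k I x :=
  mk_mulMapFun k A x I

theorem mulMap_inl_mul_inr (b c : A) :
    mulMap k A (CompletedTensor.inl k A A b * CompletedTensor.inr k A A c) = b * c :=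
  IsPseudocompactAlgebra.eq_of_mk_eq k A fun I => by
    rw [mk_mulMap]
    simp only [mulComponent, LinearMap.comp_apply, AlgHom.toLinearMap_apply, map_mul]
    change LinearMap.mul' k (A ⧸ I.ideal)
      ((Ideal.Quotient.mk I.ideal b ⊗ₜ 1) * (1 ⊗ₜ Ideal.Quotient.mk I.ideal c)) = _
    simp

theorem isBimoduleHom_mulMap : IsBimoduleHom A (mulMap k A) :=
  ⟨fun a x => IsPseudocompactAlgebra.eq_of_mk_eq k A fun I => by
      rw [mk_mulMap, mulComponent_smul, smul_eq_mul, map_mul, mk_mulMap],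
    fun a x => IsPseudocompactAlgebra.eq_of_mk_eq k A fun I => by
      rw [mk_mulMap, mulComponent_op_smul, op_smul_eq_mul, map_mul, mk_mulMap]⟩

/-- The kernel of the multiplication map, with the subspace topology. -/
abbrev KerMul : Type _ := ↥(LinearMap.ker (mulMap k A).toLinearMap)

namespace KerMul

noncomputable instance : SMul A (KerMul k A) :=
  ⟨fun a x => ⟨a • x.1, by
    have h : mulMap k A x.1 = 0 := x.2
    change mulMap k A (a • x.1) = 0
    rw [(isBimoduleHom_mulMap k A).1, h, smul_zero]⟩⟩

noncomputable instance : SMul Aᵐᵒᵖ (KerMul k A) :=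
  ⟨fun r x => ⟨r • x.1, by
    have h : mulMap k A x.1 = 0 := x.2
    change mulMap k A (op r.unop • x.1) = 0
    rw [(isBimoduleHom_mulMap k A).2, h, smul_zero]⟩⟩

/-- The left action inherited from the completed tensor product. -/
noncomputable instance : Module A (KerMul k A) :=
  Function.Injective.module A (LinearMap.ker (mulMap k A).toLinearMap).subtype.toAddMonoidHom
    Subtype.val_injective (fun _ _ => rfl)

/-- The right action inherited from the completed tensor product. -/
noncomputable instance : Module Aᵐᵒᵖ (KerMul k A) :=
  Function.Injective.module Aᵐᵒᵖ (LinearMap.ker (mulMap k A).toLinearMap).subtype.toAddMonoidHom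
    Subtype.val_injective (fun _ _ => rfl)

end KerMul

/-- The universal derivation `a ↦ 1 ⊗ a - a ⊗ 1`, with values in the kernel of multiplication. -/
noncomputable def universalDerivation : A →L[k] KerMul k A where
  toFun a := ⟨CompletedTensor.inr k A A a - CompletedTensor.inl k A A a, by
    have h1 := mulMap_inl_mul_inr k A 1 a
    have h2 := mulMap_inl_mul_inr k A a 1
    simp only [map_one, one_mul, mul_one] at h1 h2
    change mulMap k A _ = 0
    rw [map_sub, h1, h2, sub_self]⟩
  map_add' a b := Subtype.ext (by simp only [map_add, Submodule.coe_add]; abel)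
  map_smul' c a := Subtype.ext (by
    simp only [map_smul, RingHom.id_apply, Submodule.coe_smul, smul_sub])
  cont := by
    have := hA.isTopologicalRing
    refine Continuous.subtype_mk ?_ _
    refine Continuous.sub ?_ ?_
    · refine InverseLimit.continuous_iff.2 fun p b => isOpen_iff_mem_nhds.2 fun a ha => ?_
      have hn : (fun x => x - a) ⁻¹' (p.2.ideal : Set A) ∈ 𝓝 a :=
        (p.2.isOpen.preimage (by fun_prop)).mem_nhds (by simp)
      refine mem_of_superset hn fun x hx => ?_
      have hx' : Ideal.Quotient.mk p.2.ideal x = Ideal.Quotient.mk p.2.ideal a :=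
        Ideal.Quotient.eq.2 hx
      simp only [Set.mem_preimage, CompletedTensor.proj_inr, Set.mem_singleton_iff, hx'] at ha ⊢
      exact ha
    · refine InverseLimit.continuous_iff.2 fun p b => isOpen_iff_mem_nhds.2 fun a ha => ?_
      have hn : (fun x => x - a) ⁻¹' (p.1.ideal : Set A) ∈ 𝓝 a :=
        (p.1.isOpen.preimage (by fun_prop)).mem_nhds (by simp)
      refine mem_of_superset hn fun x hx => ?_
      have hx' : Ideal.Quotient.mk p.1.ideal x = Ideal.Quotient.mk p.1.ideal a :=
        Ideal.Quotient.eq.2 hx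
      simp only [Set.mem_preimage, CompletedTensor.proj_inl, Set.mem_singleton_iff, hx'] at ha ⊢
      exact ha

theorem isDerivation_universalDerivation : IsDerivation (universalDerivation k A) := fun a b =>
  Subtype.ext (by
    change CompletedTensor.inr k A A (a * b) - CompletedTensor.inl k A A (a * b) =
      CompletedTensor.inl k A A a * (CompletedTensor.inr k A A b - CompletedTensor.inl k A A b) +
      (CompletedTensor.inr k A A a - CompletedTensor.inl k A A a) * CompletedTensor.inr k A A b
    rw [map_mul, map_mul]
    noncomm_ring)


end Multiplication

/-! ### Products of matrix algebras and inverse limits -/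

/-- `A` is isomorphic, as a topological algebra, to a product of matrix algebras over
finite-dimensional division `k`-algebras whose centres are separable field extensions of `k`. The
division algebras are discrete and the product has the product topology. -/
def IsProductOfSeparableMatrixAlgebras (k : Type v) (A : Type u) [Field k] [Ring A] [Algebra k A]
    [TopologicalSpace A] : Prop :=
  ∃ (ι : Type u) (n : ι → ℕ) (Δ : ι → Type u) (_ : ∀ i, DivisionRing (Δ i))
    (_ : ∀ i, Algebra k (Δ i)) (_ : ∀ i, TopologicalSpace (Δ i)),
    (∀ i, 0 < n i ∧ DiscreteTopology (Δ i) ∧ FiniteDimensional k (Δ i) ∧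
      Algebra.IsSeparable k (Subalgebra.center k (Δ i))) ∧
    Nonempty (A ≃A[k] ∀ i, Matrix (Fin (n i)) (Fin (n i)) (Δ i))

/-- `A` is isomorphic, as a topological algebra, to the inverse limit of a directed inverse system
of discrete finite-dimensional separable algebras. -/
def IsInverseLimitOfSeparable (k : Type v) (A : Type u) [Field k] [Ring A] [Algebra k A]
    [TopologicalSpace A] : Prop :=
  ∃ (ι : Type u) (_ : Preorder ι) (_ : IsDirectedOrder ι) (_ : Nonempty ι) (B : ι → Type u)
    (_ : ∀ i, Ring (B i)) (_ : ∀ i, Algebra k (B i)) (_ : ∀ i, TopologicalSpace (B i))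
    (φ : ∀ ⦃i j : ι⦄, i ≤ j → B j →ₐ[k] B i),
    InverseSystem (fun _ _ h => φ h) ∧
    (∀ i, DiscreteTopology (B i) ∧ FiniteDimensional k (B i) ∧ IsSeparableAlgebra k (B i)) ∧
    Nonempty (A ≃A[k] InverseLimit φ)

/-! Everything is compared with the existence of a separability idempotent `p`, and the proof has a
formal half and a structural half.

Formal half. A continuous linear map `d : A → T` into a pseudocompact bimodule extends to a
continuous map `Φ` on the completed tensor square with `Φ(a ⊗ b) = d(a) b`
(`exists_completedTensor_map`). If `d` is a derivation, `Φ` is right linear and fails to be left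
linear exactly by `d(a) m(x)`; evaluating at `p` shows that `Φ p` makes `d` inner. If instead `d(a)
= a • m` for a lift `m` of `g 1`, then `a ↦ Φ(a p)` lifts `g`, which gives projectivity. Conversely,
projectivity splits `m`, a splitting sends `1` to a separability idempotent, and if `u` makes the
universal derivation inner then `1 ⊗ 1 - u` is one.

Structural half. Each of the conditions on the shape of `A` is equivalent to every discrete quotient
`A ⧸ I` having a separability idempotent. In finite dimension this is classical: averaging a
projection over `p` shows that base changes are semisimple (`isSemisimpleRing_tensor_left`);
conversely semisimple base changes force separable centres in the Wedderburn decomposition, because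
an inseparable central element yields a central nilpotent over a splitting field. Idempotents are
then built from separable fields, central division algebras, transitivity, matrices and finite
products.

The passage from discrete quotients to `A` is linear compactness (`exists_forall_mem`): a directed
family of nonempty closed affine subspaces has a common point. It produces `p` from idempotents
modulo each `I`, surjectivity of `A → ∏ M_n(Δ)`, minimal closed complements of left ideals, and the
description of images of an inverse limit as images of transition maps. -/

/-! ### Linear compactness of pseudocompact vector spaces -/

/-- A topological vector space over the discrete field `k` is pseudocompact if it is complete and
has a basis of neighbourhoods of `0` consisting of open subspaces of finite codimension. -/
structure IsPseudocompactSpace (k V : Type*) [Field k] [AddCommGroup V] [Module k V]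
    [TopologicalSpace V] : Prop where
  isTopologicalAddGroup : IsTopologicalAddGroup V
  completeSpace : letI := IsTopologicalAddGroup.rightUniformSpace V; CompleteSpace V
  hasBasis : (𝓝 (0 : V)).HasBasis
    (fun N : Submodule k V => IsOpen (N : Set V) ∧ FiniteDimensional k (V ⧸ N))
    (fun N => (N : Set V))

theorem cauchy_rightUniformSpace_iff {V : Type*} [AddCommGroup V] [TopologicalSpace V]
    [IsTopologicalAddGroup V] {F : Filter V} :
    (letI := IsTopologicalAddGroup.rightUniformSpace V; Cauchy F) ↔
      F.NeBot ∧ ∀ U ∈ 𝓝 (0 : V), ∃ s ∈ F, ∀ x ∈ s, ∀ y ∈ s, y - x ∈ U := by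
  let := IsTopologicalAddGroup.rightUniformSpace V
  rw [cauchy_iff]
  refine and_congr_right fun _ => ⟨fun h U hU => ?_, fun h S hS => ?_⟩
  · obtain ⟨t, ht, h⟩ := h ((fun p : V × V => p.2 - p.1) ⁻¹' U) (by
      rw [uniformity_eq_comap_nhds_zero' V]
      exact ⟨U, hU, fun p hp => by simpa [sub_eq_add_neg] using hp⟩)
    exact ⟨t, ht, fun x hx y hy => h (Set.mk_mem_prod hx hy)⟩
  · rw [uniformity_eq_comap_nhds_zero' V] at hS
    obtain ⟨U, hU, hUS⟩ := hS
    obtain ⟨s, hs, h⟩ := h U hU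
    refine ⟨s, hs, ?_⟩
    rintro ⟨x, y⟩ ⟨hx, hy⟩
    exact hUS (by simpa [sub_eq_add_neg] using h x hx y hy)

namespace IsPseudocompactSpace

variable {k V : Type*} [Field k] [AddCommGroup V] [Module k V]

/-- A maximal directed family of nonempty affine subspaces contains subspaces with arbitrarily small
image modulo a subspace of finite codimension. -/
theorem exists_mem_of_maximal {M : Set (AffineSubspace k V)}
    (hM : Maximal (· ∈ {M : Set (AffineSubspace k V) | M.Nonempty ∧ DirectedOn (· ≥ ·) M ∧
      ∀ s ∈ M, (s : Set V).Nonempty}) M)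
    (N : Submodule k V) [FiniteDimensional k (V ⧸ N)] :
    ∃ s ∈ M, ∀ x ∈ s, ∀ y ∈ s, y - x ∈ N := by
  obtain ⟨⟨hne, hd, hs⟩, hmax⟩ := hM
  -- Minimality of the rank modulo `N` makes every member of `M` below `s₀` have the same directions
  -- modulo `N` as `s₀`. Hence it meets the coset `w + N`, and so does every member of `M`, by
  -- directedness.
  let r : AffineSubspace k V → ℕ := fun s => Module.finrank k (s.direction.map N.mkQ)
  obtain ⟨s₀, hs₀, hmin⟩ := exists_minimalFor_of_wellFoundedLT (· ∈ M) r hne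
  obtain ⟨w, hw⟩ := hs s₀ hs₀
  let t : AffineSubspace k V := AffineSubspace.mk' w N
  have ht : ∀ s ∈ M, ((t ⊓ s : AffineSubspace k V) : Set V).Nonempty := by
    intro s hsM
    obtain ⟨u, huM, hu, hu₀⟩ := hd s hsM s₀ hs₀
    obtain ⟨a, ha⟩ := hs u huM
    have hle : u.direction.map N.mkQ ≤ s₀.direction.map N.mkQ :=
      Submodule.map_mono (AffineSubspace.direction_le hu₀)
    have heq := Submodule.eq_of_le_of_finrank_le hle
      (hmin huM (Submodule.finrank_mono hle))
    have hwa : w - a ∈ s₀.direction := AffineSubspace.vsub_mem_direction hw (hu₀ ha)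
    have := Submodule.mem_map_of_mem (f := N.mkQ) hwa
    rw [← heq] at this
    obtain ⟨d, hd, hdw⟩ := this
    refine ⟨d + a, ?_, hu (AffineSubspace.vadd_mem_of_mem_direction hd ha)⟩
    change d + a - w ∈ N
    have h2 := (Submodule.Quotient.eq N).1 hdw
    convert h2 using 1
    abel
  -- Cutting every member by the coset `t` keeps the family directed with nonempty members, so
  -- maximality forces the cut subspaces to be in `M` already.
  have key : M ∪ (t ⊓ ·) '' M ⊆ M := by
    refine hmax ⟨hne.mono Set.subset_union_left, ?_, ?_⟩ Set.subset_union_left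
    · have : ∀ x ∈ M ∪ (t ⊓ ·) '' M, ∃ y ∈ M, t ⊓ y ≤ x := by
        rintro x (hx | ⟨y, hy, rfl⟩)
        · exact ⟨x, hx, inf_le_right⟩
        · exact ⟨y, hy, le_rfl⟩
      intro x hx y hy
      obtain ⟨x', hx', hxx⟩ := this x hx
      obtain ⟨y', hy', hyy⟩ := this y hy
      obtain ⟨z, hz, hzx, hzy⟩ := hd x' hx' y' hy'
      exact ⟨t ⊓ z, Or.inr ⟨z, hz, rfl⟩, (inf_le_inf_left t hzx).trans hxx,
        (inf_le_inf_left t hzy).trans hyy⟩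
    · rintro x (hx | ⟨y, hy, rfl⟩)
      · exact hs x hx
      · exact ht y hy
  refine ⟨t ⊓ s₀, key (Or.inr ⟨s₀, hs₀, rfl⟩), fun x hx y hy => ?_⟩
  have hx' : x - w ∈ N := hx.1
  have hy' : y - w ∈ N := hy.1
  simpa using N.sub_mem hy' hx'

variable [TopologicalSpace V]

/-- Linear compactness: a directed family of nonempty closed affine subspaces of a pseudocompact
vector space has a common point. -/
theorem exists_forall_mem (hV : IsPseudocompactSpace k V) {ι : Type*} [Nonempty ι]
    (s : ι → AffineSubspace k V) (hd : Directed (· ≥ ·) s)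
    (hne : ∀ i, (s i : Set V).Nonempty) (hc : ∀ i, IsClosed (s i : Set V)) :
    ∃ x, ∀ i, x ∈ s i := by
  have := hV.isTopologicalAddGroup
  -- Members of the enlarged family are not required to be closed; closedness matters only for the
  -- original `s i`, when the limit point is placed in them.
  obtain ⟨M, hsM, hM⟩ := zorn_subset_nonempty
    {M : Set (AffineSubspace k V) | M.Nonempty ∧ DirectedOn (· ≥ ·) M ∧
      ∀ s ∈ M, (s : Set V).Nonempty} (by
    intro c hcS hch hcn
    refine ⟨⋃₀ c, ⟨?_, ?_, ?_⟩, fun s hs => Set.subset_sUnion_of_mem hs⟩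
    · obtain ⟨m, hm⟩ := hcn
      exact (hcS hm).1.mono (Set.subset_sUnion_of_mem hm)
    · rintro x ⟨m, hm, hx⟩ y ⟨m', hm', hy⟩
      obtain ⟨l, hl, hml, hml'⟩ := hch.directedOn m hm m' hm'
      obtain ⟨z, hz, h⟩ := (hcS hl).2.1 x (hml hx) y (hml' hy)
      exact ⟨z, ⟨l, hl, hz⟩, h⟩
    · rintro x ⟨m, hm, hx⟩
      exact (hcS hm).2.2 x hx) (Set.range s)
    ⟨Set.range_nonempty s, hd.directedOn_range, by rintro _ ⟨i, rfl⟩; exact hne i⟩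
  -- By maximality this filter contains sets that are small modulo every open subspace of finite
  -- codimension, so it is Cauchy.
  let F : Filter V := ⨅ t : M, 𝓟 (t.1 : Set V)
  have hF : ∀ t ∈ M, (t : Set V) ∈ F := fun t ht =>
    mem_iInf_of_mem (⟨t, ht⟩ : M) (mem_principal_self _)
  have : Nonempty M := hM.1.1.to_subtype
  have hFn : F.NeBot := by
    refine iInf_neBot_of_directed ?_ fun t => principal_neBot_iff.2 (hM.1.2.2 t.1 t.2)
    intro a b
    obtain ⟨z, hz, hza, hzb⟩ := hM.1.2.1 a.1 a.2 b.1 b.2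
    exact ⟨⟨z, hz⟩, principal_mono.2 hza, principal_mono.2 hzb⟩
  have hFc := cauchy_rightUniformSpace_iff.2 ⟨hFn, fun U hU => by
    obtain ⟨N, ⟨-, hN⟩, hNU⟩ := hV.hasBasis.mem_iff.1 hU
    obtain ⟨t, ht, h⟩ := exists_mem_of_maximal hM N
    exact ⟨t, hF t ht, fun x hx y hy => hNU (h x hx y hy)⟩⟩
  obtain ⟨x, hx⟩ := hV.completeSpace.complete hFc
  exact ⟨x, fun i => isClosed_iff_clusterPt.1 (hc i) x
    ((ClusterPt.of_le_nhds hx).mono (le_principal_iff.2 (hF _ (hsM ⟨i, rfl⟩))))⟩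

end IsPseudocompactSpace

/-! ### Inverse limits of discrete algebras -/

namespace InverseLimit

variable {k : Type*} [Field k] {ι : Type*} [Preorder ι] {B : ι → Type*} [∀ i, Ring (B i)]
  [∀ i, Algebra k (B i)] {φ : ∀ ⦃i j : ι⦄, i ≤ j → B j →ₐ[k] B i}

instance : IsTopologicalRing (InverseLimit φ) where
  continuous_mul := by
    refine (continuousMul_iInf fun i => ?_).continuous_mul
    let : TopologicalSpace (B i) := ⊥
    have : DiscreteTopology (B i) := ⟨rfl⟩
    exact continuousMul_induced (proj φ i)

theorem isOpen_ker_proj (i : ι) : 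
    IsOpen (LinearMap.ker (proj φ i).toLinearMap : Set (InverseLimit φ)) :=
  isOpen_preimage_proj φ i {0}

instance : T2Space (InverseLimit φ) := by
  refine ⟨fun x y hxy => ?_⟩
  obtain ⟨i, hi⟩ : ∃ i, proj φ i x ≠ proj φ i y := by
    by_contra! h
    exact hxy (ext h)
  exact ⟨_, _, isOpen_preimage_proj φ i {proj φ i x}, isOpen_preimage_proj φ i {proj φ i y},
    rfl, rfl, (Set.disjoint_singleton.2 hi).preimage _⟩

theorem continuous_of_isOpen_ker {V F : Type*} [AddGroup V] [TopologicalSpace V]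
    [IsTopologicalAddGroup V] [FunLike F V (InverseLimit φ)]
    [AddMonoidHomClass F V (InverseLimit φ)] (f : F)
    (h : ∀ i, IsOpen {v | proj φ i (f v) = 0}) : Continuous f := by
  refine continuous_iff.2 fun i b => isOpen_iff_mem_nhds.2 fun a ha => ?_
  have hn : (fun x => x - a) ⁻¹' {v | proj φ i (f v) = 0} ∈ 𝓝 a :=
    ((h i).preimage (by fun_prop)).mem_nhds (by simp)
  refine mem_of_superset hn fun x hx => ?_
  have hx : proj φ i (f (x - a)) = 0 := hx
  rw [map_sub, map_sub, sub_eq_zero] at hx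
  exact hx.trans ha

variable [Nonempty ι] [IsDirectedOrder ι]

instance {κ : Type*} [Preorder κ] [IsDirectedOrder κ] : IsDirectedOrder (ι × κ) :=
  ⟨fun p q =>
    let ⟨i, hi, hi'⟩ := exists_ge_ge p.1 q.1
    let ⟨j, hj, hj'⟩ := exists_ge_ge p.2 q.2
    ⟨(i, j), ⟨hi, hj⟩, ⟨hi', hj'⟩⟩⟩

/-- Directedness replaces finite intersections of kernels by the kernel of a single projection
further along the system. -/
theorem hasBasis_nhds_zero : (𝓝 (0 : InverseLimit φ)).HasBasis (fun _ : ι => True)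
    (fun i => (LinearMap.ker (proj φ i).toLinearMap : Set (InverseLimit φ))) := by
  have h : 𝓝 (0 : InverseLimit φ) =
      ⨅ i, 𝓟 (LinearMap.ker (proj φ i).toLinearMap : Set (InverseLimit φ)) := by
    rw [nhds_iInf]
    refine iInf_congr fun i => ?_
    let : TopologicalSpace (B i) := ⊥
    have : DiscreteTopology (B i) := ⟨rfl⟩
    rw [nhds_induced, nhds_discrete, map_zero, ← principal_singleton, comap_principal]
    rfl
  rw [h]
  refine hasBasis_iInf_principal fun i j => ?_
  obtain ⟨l, hi, hj⟩ := exists_ge_ge i j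
  refine ⟨l, fun x hx => ?_, fun x hx => ?_⟩ <;>
  · have hx : proj φ l x = 0 := hx
    change proj φ _ x = 0
    rw [← proj_compat x (by assumption), hx, map_zero]

/-- A Cauchy filter is eventually constant in each discrete coordinate. The constants are compatible
because any two sets of the filter meet, and they form its limit. -/
theorem isPseudocompactSpace (hB : ∀ i, FiniteDimensional k (B i)) :
    IsPseudocompactSpace k (InverseLimit φ) where
  isTopologicalAddGroup := inferInstance
  completeSpace := by
    let := IsTopologicalAddGroup.rightUniformSpace (InverseLimit φ)
    refine ⟨fun {F} hF => ?_⟩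
    obtain ⟨hFn, h⟩ := cauchy_rightUniformSpace_iff.1 hF
    choose s hs h using fun i => h _ ((isOpen_ker_proj (φ := φ) i).mem_nhds (zero_mem _))
    have hne : ∀ i, (s i).Nonempty := fun i => hFn.nonempty_of_mem (hs i)
    choose x hx using hne
    have key : ∀ i, ∀ y ∈ s i, proj φ i y = proj φ i (x i) := fun i y hy => by
      have : proj φ i (y - x i) = 0 := h i _ (hx i) _ hy
      rwa [map_sub, sub_eq_zero] at this
    obtain ⟨z, hz⟩ : ∃ z : InverseLimit φ, ∀ i, proj φ i z = proj φ i (x i) := by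
      refine ⟨⟨fun i => proj φ i (x i), fun i j hij => ?_⟩, fun i => rfl⟩
      obtain ⟨y, hyi, hyj⟩ := hFn.nonempty_of_mem (inter_mem (hs i) (hs j))
      change φ hij (proj φ j (x j)) = proj φ i (x i)
      rw [← key i y hyi, ← key j y hyj, proj_compat]
    refine ⟨z, fun U hU => ?_⟩
    rw [← map_add_left_nhds_zero, mem_map, hasBasis_nhds_zero.mem_iff] at hU
    obtain ⟨i, -, hi⟩ := hU
    refine mem_of_superset (hs i) fun y hy => ?_
    have := @hi (-z + y) (by
      change proj φ i (_ + y) = 0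
      rw [map_add, map_neg, key i y hy, hz, neg_add_cancel])
    simpa using this
  hasBasis := hasBasis_nhds_zero.to_hasBasis
    (fun i _ => ⟨_, ⟨isOpen_ker_proj i, by
      exact Module.Finite.equiv (proj φ i).toLinearMap.quotKerEquivRange.symm⟩, subset_rfl⟩)
    (fun N hN => by
      obtain ⟨i, -, hi⟩ := hasBasis_nhds_zero.mem_iff.1 (hN.1.mem_nhds (zero_mem N))
      exact ⟨i, trivial, hi⟩)

end InverseLimit

/-! ### Pseudocompact algebras as pseudocompact vector spaces -/

namespace IsPseudocompactAlgebra

variable (k : Type*) (A : Type*) [Field k] [Ring A] [Algebra k A] [TopologicalSpace A]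
  [hA : IsPseudocompactAlgebra k A]

theorem isPseudocompactSpace : IsPseudocompactSpace k A where
  isTopologicalAddGroup := hA.isTopologicalRing.to_topologicalAddGroup
  completeSpace := hA.completeSpace
  hasBasis := hA.hasBasis.to_hasBasis
    (fun I hI => ⟨I.restrictScalars k, hI.2, subset_rfl⟩)
    (fun N hN => by
      obtain ⟨I, hI, h⟩ := hA.hasBasis.mem_iff.1 (hN.1.mem_nhds (zero_mem N))
      exact ⟨I, hI, h⟩)

variable {A}

theorem finiteDimensional_quotient (I : OpenIdeal A) : FiniteDimensional k (A ⧸ I.ideal) := by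
  obtain ⟨J, ⟨-, -, hJ⟩, h⟩ := hA.hasBasis.mem_iff.1 (I.isOpen.mem_nhds (zero_mem I.ideal))
  let f : (A ⧸ J.restrictScalars k) →ₗ[k] (A ⧸ I.ideal) :=
    (J.restrictScalars k).liftQ (Ideal.Quotient.mkₐ k I.ideal).toLinearMap fun x hx =>
      Ideal.Quotient.eq_zero_iff_mem.2 (h hx)
  exact Module.Finite.of_surjective f fun x => by
    obtain ⟨a, rfl⟩ := Ideal.Quotient.mk_surjective x
    exact ⟨Submodule.Quotient.mk a, rfl⟩

end IsPseudocompactAlgebra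

namespace OpenIdeal

variable {A : Type*} [Ring A] [TopologicalSpace A]

instance : Nonempty (OpenIdeal A) := ⟨⟨⊤, inferInstance, isOpen_univ⟩⟩

instance : Min (OpenIdeal A) :=
  ⟨fun I J => ⟨I.ideal ⊓ J.ideal,
    ⟨fun b h => ⟨I.ideal.mul_mem_right b h.1, J.ideal.mul_mem_right b h.2⟩⟩,
    I.isOpen.inter J.isOpen⟩⟩

instance : IsDirectedOrder (OpenIdeal A) :=
  ⟨fun I J => ⟨I ⊓ J, (inf_le_left : I.ideal ⊓ J.ideal ≤ I.ideal),
    (inf_le_right : I.ideal ⊓ J.ideal ≤ J.ideal)⟩⟩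

end OpenIdeal

/-! ### Density and linear compactness of the completed tensor product -/

section CompletedTensor

variable (k : Type*) (A B : Type*) [Field k] [Ring A] [Algebra k A] [TopologicalSpace A]
  [Ring B] [Algebra k B] [TopologicalSpace B]

namespace CompletedTensor

/-- The canonical map `A ⊗ B → A ⊗̂ B`. -/
noncomputable def ofTensor : A ⊗[k] B →ₐ[k] CompletedTensor k A B :=
  InverseLimit.lift (quotientTensorMap k A B)
    (fun p => Algebra.TensorProduct.map (Ideal.Quotient.mkₐ k p.1.ideal)
      (Ideal.Quotient.mkₐ k p.2.ideal))
    (fun _ _ _ _ => by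
      induction ‹A ⊗[k] B› with
      | zero => simp
      | tmul a b => simp [quotientTensorMap]
      | add x y hx hy => simp only [map_add, hx, hy])

variable {k A B}

theorem ofTensor_tmul (a : A) (b : B) :
    ofTensor k A B (a ⊗ₜ b) = inl k A B a * inr k A B b :=
  InverseLimit.ext fun p => by
    rw [map_mul, proj_inl, proj_inr, ofTensor, InverseLimit.proj_lift]
    simp

theorem proj_ofTensor_surjective (p : OpenIdeal A × OpenIdeal B) :
    Function.Surjective
      (fun x => InverseLimit.proj (quotientTensorMap k A B) p (ofTensor k A B x)) :=
  TensorProduct.map_surjective Ideal.Quotient.mk_surjective Ideal.Quotient.mk_surjective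

theorem proj_surjective (p : OpenIdeal A × OpenIdeal B) :
    Function.Surjective (InverseLimit.proj (quotientTensorMap k A B) p) := fun y =>
  let ⟨_, hx⟩ := proj_ofTensor_surjective p y
  ⟨_, hx⟩

theorem denseRange_ofTensor : DenseRange (ofTensor k A B) := by
  intro x
  rw [mem_closure_iff_nhds]
  intro U hU
  rw [← map_add_left_nhds_zero, mem_map, InverseLimit.hasBasis_nhds_zero.mem_iff] at hU
  obtain ⟨p, -, hp⟩ := hU
  obtain ⟨y, hy⟩ := proj_ofTensor_surjective p (InverseLimit.proj _ p x)
  refine ⟨_, ?_, y, rfl⟩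
  have := @hp (-x + ofTensor k A B y) (by
    change InverseLimit.proj _ p (_ + _) = 0
    have hy : InverseLimit.proj _ p (ofTensor k A B y) = _ := hy
    rw [map_add, map_neg, hy, neg_add_cancel])
  simpa using this

theorem continuous_inl [IsTopologicalAddGroup A] : Continuous (inl k A B) :=
  InverseLimit.continuous_of_isOpen_ker _ fun p => by
    refine AddSubgroup.isOpen_mono (H₁ := p.1.ideal.toAddSubgroup) (H₂ := AddMonoidHom.ker
      ((InverseLimit.proj (quotientTensorMap k A B) p).comp (inl k A B)).toLinearMap.toAddMonoidHom)
      (fun a ha => ?_) p.1.isOpen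
    change InverseLimit.proj (quotientTensorMap k A B) p (inl k A B a) = 0
    rw [proj_inl, Ideal.Quotient.eq_zero_iff_mem.2 ha, TensorProduct.zero_tmul]

theorem continuous_inr [IsTopologicalAddGroup B] : Continuous (inr k A B) :=
  InverseLimit.continuous_of_isOpen_ker _ fun p => by
    refine AddSubgroup.isOpen_mono (H₁ := p.2.ideal.toAddSubgroup) (H₂ := AddMonoidHom.ker
      ((InverseLimit.proj (quotientTensorMap k A B) p).comp (inr k A B)).toLinearMap.toAddMonoidHom)
      (fun a ha => ?_) p.2.isOpen
    change InverseLimit.proj (quotientTensorMap k A B) p (inr k A B a) = 0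
    rw [proj_inr, Ideal.Quotient.eq_zero_iff_mem.2 ha, TensorProduct.tmul_zero]

variable (k A B)

theorem isPseudocompactSpace [IsPseudocompactAlgebra k A] [IsPseudocompactAlgebra k B] :
    IsPseudocompactSpace k (CompletedTensor k A B) :=
  InverseLimit.isPseudocompactSpace fun p => by
    have := IsPseudocompactAlgebra.finiteDimensional_quotient k p.1
    have := IsPseudocompactAlgebra.finiteDimensional_quotient k p.2
    infer_instance

end CompletedTensor

end CompletedTensor

/-! ### Maps from the completed tensor square into pseudocompact bimodules -/

section Bimodule

namespace IsPseudocompactBimodule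

variable {k : Type*} {A T : Type*} [Field k] [Ring A] [Algebra k A]
  [TopologicalSpace A] [AddCommGroup T] [Module k T] [Module A T] [Module Aᵐᵒᵖ T]
  [IsScalarTower k A T] [IsScalarTower k Aᵐᵒᵖ T] [SMulCommClass A Aᵐᵒᵖ T]
  [TopologicalSpace T]

/-- The bilinear map `a ⊗ b ↦ d(a) b`. -/
noncomputable def rightMul (d : A →L[k] T) : A ⊗[k] A →ₗ[k] T :=
  TensorProduct.lift (LinearMap.mk₂ k (fun a b => op b • d a)
    (fun a a' b => by rw [map_add, smul_add])
    (fun c a b => by rw [map_smul, smul_comm])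
    (fun a b b' => by rw [op_add, add_smul])
    (fun c a b => by rw [op_smul, smul_assoc]))

@[simp]
theorem rightMul_tmul (d : A →L[k] T) (a b : A) : rightMul d (a ⊗ₜ b) = op b • d a := rfl

variable [hA : IsPseudocompactAlgebra k A]

/-- The right action of `A` on a finite-dimensional discrete quotient factors through a discrete
quotient of `A`. -/
theorem exists_openIdeal_op_smul_mem (hT : IsPseudocompactBimodule k A T) (N : Submodule k T)
    (hNo : IsOpen (N : Set T)) (hN : ∀ a : A, ∀ x ∈ N, op a • x ∈ N)
    [FiniteDimensional k (T ⧸ N)] :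
    ∃ J : OpenIdeal A, ∀ b ∈ J.ideal, ∀ x : T, op b • x ∈ N := by
  have := hT.continuousSMul_right
  let e := Module.finBasis k (T ⧸ N)
  choose t ht using fun i => N.mkQ_surjective (e i)
  -- It suffices to control the finitely many lifts `t i` of a basis of `T ⧸ N`: any `x` is a
  -- combination of them plus an element of the stable subspace `N`.
  have hU : (⋂ i, {b : A | op b • t i ∈ N}) ∈ 𝓝 (0 : A) := by
    rw [iInter_mem]
    intro i
    refine (hNo.preimage (f := fun b : A => op b • t i) ?_).mem_nhds ?_
    · exact (continuous_op.smul continuous_const)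
    · simp
  obtain ⟨J, hJ⟩ := IsPseudocompactAlgebra.exists_openIdeal k A hU
  refine ⟨J, fun b hb x => ?_⟩
  have hx : x - ∑ i, e.repr (N.mkQ x) i • t i ∈ N := by
    rw [← Submodule.Quotient.mk_eq_zero, ← Submodule.mkQ_apply, map_sub, map_sum]
    simp_rw [map_smul, ht, e.sum_repr, sub_self]
  have h2 : op b • (∑ i, e.repr (N.mkQ x) i • t i) ∈ N := by
    rw [Finset.smul_sum]
    refine N.sum_mem fun i _ => ?_
    rw [smul_comm]
    exact N.smul_mem _ (Set.mem_iInter.1 (hJ hb) i)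
  have := N.add_mem (hN b _ hx) h2
  rwa [← smul_add, sub_add_cancel] at this

/-- A continuous linear map `d : A → T` extends to a continuous map on the completed tensor square
with `a ⊗ b ↦ d(a) b`. -/
theorem exists_completedTensor_map (hT : IsPseudocompactBimodule k A T) (d : A →L[k] T) :
    ∃ Φ : CompletedTensor k A A →L[k] T, ∀ x,
      Φ (CompletedTensor.ofTensor k A A x) = rightMul d x := by
  have := hT.isTopologicalAddGroup
  have := hT.t2Space
  have := hT.continuousSMul_left
  let uT := IsTopologicalAddGroup.rightUniformSpace T
  have : IsUniformAddGroup T := isUniformAddGroup_of_addCommGroup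
  have : CompleteSpace T := hT.completeSpace
  let uC := IsTopologicalAddGroup.rightUniformSpace (CompletedTensor k A A)
  have : IsUniformAddGroup (CompletedTensor k A A) := isUniformAddGroup_of_addCommGroup
  -- With the uniformity pulled back from the completion, the canonical map is uniformly inducing
  -- with dense range, and a continuous linear map into the complete `T` extends.
  let uE : UniformSpace (A ⊗[k] A) := uC.comap (CompletedTensor.ofTensor k A A)
  have : IsUniformAddGroup (A ⊗[k] A) := IsUniformAddGroup.comap (CompletedTensor.ofTensor k A A)
  have hind : IsUniformInducing (CompletedTensor.ofTensor k A A) := ⟨rfl⟩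
  have : ContinuousConstSMul k T := ⟨fun c => by
    simpa only [algebraMap_smul] using
      (continuous_const_smul (algebraMap k A c) : Continuous fun x : T => _ • x)⟩
  have : ContinuousConstSMul k (CompletedTensor k A A) := ⟨fun c => by
    simpa only [Algebra.smul_def] using continuous_const_mul _⟩
  let e : A ⊗[k] A →L[k] CompletedTensor k A A :=
    ⟨(CompletedTensor.ofTensor k A A).toLinearMap, hind.uniformContinuous.continuous⟩
  have hf : Continuous (rightMul d) := by
    refine continuous_of_continuousAt_zero (rightMul d) ?_
    intro U hU
    rw [map_zero] at hU
    obtain ⟨N, ⟨hNo, -, hN, hNf⟩, hNU⟩ := hT.hasBasis.mem_iff.1 hU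
    obtain ⟨J, hJ⟩ := exists_openIdeal_op_smul_mem hT N hNo hN
    obtain ⟨I, hI⟩ := IsPseudocompactAlgebra.exists_openIdeal k A
      ((hNo.preimage d.continuous).mem_nhds (by simp : (0 : A) ∈ d ⁻¹' N))
    have hn : 𝓝 (0 : A ⊗[k] A) =
        (𝓝 (0 : CompletedTensor k A A)).comap (CompletedTensor.ofTensor k A A) := by
      rw [hind.isInducing.nhds_eq_comap, map_zero]
    rw [mem_map, hn]
    refine ⟨_, (InverseLimit.isOpen_ker_proj (I, J)).mem_nhds (zero_mem _), fun x hx => hNU ?_⟩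
    have hx : InverseLimit.proj _ (I, J) (CompletedTensor.ofTensor k A A x) = 0 := hx
    have hex : ∀ K : OpenIdeal A, Function.Exact (K.ideal.restrictScalars k).subtype
        (Ideal.Quotient.mkₐ k K.ideal).toLinearMap := fun K y => by
      rw [Submodule.coe_subtype, Subtype.range_coe]
      exact Ideal.Quotient.eq_zero_iff_mem
    -- The kernel of `A ⊗ A → A ⧸ I ⊗ A ⧸ J` is the sum of the images of `A ⊗ J` and `I ⊗ A`. The
    -- first goes into `N` by the choice of `J`, the second because `d` maps `I` into `N` and `N` is
    -- stable on the right.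
    have hker : x ∈ LinearMap.ker (TensorProduct.map (Ideal.Quotient.mkₐ k I.ideal).toLinearMap
      (Ideal.Quotient.mkₐ k J.ideal).toLinearMap) := hx
    rw [TensorProduct.map_ker (hex I) Ideal.Quotient.mk_surjective (hex J)
      Ideal.Quotient.mk_surjective] at hker
    have hle : LinearMap.range ((J.ideal.restrictScalars k).subtype.lTensor A) ⊔
        LinearMap.range ((I.ideal.restrictScalars k).subtype.rTensor A) ≤
        N.comap (rightMul d) := by
      rw [sup_le_iff]
      constructor
      · rintro _ ⟨y, rfl⟩
        induction y with
        | zero => simp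
        | add y z hy hz => rw [map_add]; exact Submodule.add_mem _ hy hz
        | tmul a b => exact hJ b.1 b.2 (d a)
      · rintro _ ⟨y, rfl⟩
        induction y with
        | zero => simp
        | add y z hy hz => rw [map_add]; exact Submodule.add_mem _ hy hz
        | tmul a b => exact hN b _ (hI a.2)
    exact hle hker
  let f : A ⊗[k] A →L[k] T := ⟨rightMul d, hf⟩
  exact ⟨f.extend e, fun x =>
    ContinuousLinearMap.extend_eq f CompletedTensor.denseRange_ofTensor hind x⟩

end IsPseudocompactBimodule

end Bimodule

/-! ### The completed tensor square as a pseudocompact bimodule -/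

section Bimodule

namespace CompletedTensor

variable (k : Type*) (A : Type*) [Field k] [Ring A] [Algebra k A] [TopologicalSpace A]
  [hA : IsPseudocompactAlgebra k A]

theorem isPseudocompactBimodule : IsPseudocompactBimodule k A (CompletedTensor k A A) where
  isTopologicalAddGroup := inferInstance
  continuousSMul_left := by
    have := hA.isTopologicalRing
    exact ⟨(continuous_inl.comp continuous_fst).mul continuous_snd⟩
  continuousSMul_right := by
    have := hA.isTopologicalRing
    exact ⟨continuous_snd.mul (continuous_inr.comp (continuous_unop.comp continuous_fst))⟩
  t2Space := inferInstance
  completeSpace := (isPseudocompactSpace k A A).completeSpace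
  hasBasis := InverseLimit.hasBasis_nhds_zero.to_hasBasis
    (fun p _ => ⟨_, ⟨InverseLimit.isOpen_ker_proj p,
      fun a x hx => by
        have hx : InverseLimit.proj _ p x = 0 := hx
        change InverseLimit.proj _ p (inl k A A a * x) = 0
        rw [map_mul, hx, mul_zero],
      fun a x hx => by
        have hx : InverseLimit.proj _ p x = 0 := hx
        change InverseLimit.proj _ p (x * inr k A A a) = 0
        rw [map_mul, hx, zero_mul],
      by
        have := IsPseudocompactAlgebra.finiteDimensional_quotient k p.1
        have := IsPseudocompactAlgebra.finiteDimensional_quotient k p.2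
        exact Module.Finite.equiv (InverseLimit.proj (quotientTensorMap k A A)
          p).toLinearMap.quotKerEquivRange.symm⟩, subset_rfl⟩)
    (fun N hN => by
      obtain ⟨p, -, hp⟩ := InverseLimit.hasBasis_nhds_zero.mem_iff.1 (hN.1.mem_nhds (zero_mem N))
      exact ⟨p, trivial, hp⟩)

variable {k A}

theorem mulMap_ofTensor (x : A ⊗[k] A) :
    mulMap k A (ofTensor k A A x) = LinearMap.mul' k A x := by
  induction x with
  | zero => simp
  | tmul a b => rw [ofTensor_tmul, mulMap_inl_mul_inr, LinearMap.mul'_apply]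
  | add x y hx hy => simp only [map_add, hx, hy]

omit hA in
theorem smul_ofTensor_tmul (a b c : A) :
    a • ofTensor k A A (b ⊗ₜ c) = ofTensor k A A ((a * b) ⊗ₜ c) := by
  rw [ofTensor_tmul, ofTensor_tmul, smul_def, map_mul, mul_assoc]

omit hA in
theorem op_smul_ofTensor_tmul (a b c : A) :
    op a • ofTensor k A A (b ⊗ₜ c) = ofTensor k A A (b ⊗ₜ (c * a)) := by
  rw [ofTensor_tmul, ofTensor_tmul, op_smul_def, map_mul, mul_assoc]

end CompletedTensor

theorem mulMap_surjective (k : Type*) (A : Type*) [Field k] [Ring A] [Algebra k A]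
    [TopologicalSpace A] [hA : IsPseudocompactAlgebra k A] : Function.Surjective (mulMap k A) :=
  fun a => ⟨CompletedTensor.inl k A A a * CompletedTensor.inr k A A 1, by
    rw [mulMap_inl_mul_inr, mul_one]⟩

namespace CompletedTensor

variable {k : Type*} {A T : Type*} [Field k] [Ring A] [Algebra k A]
  [TopologicalSpace A]

/-- Continuous maps out of a completed tensor product that are additive are determined by their
values on pure tensors. -/
theorem eq_of_forall_tmul [AddCommGroup T] [TopologicalSpace T] [T2Space T]
    (f g : CompletedTensor k A A →+ T) (hf : Continuous f) (hg : Continuous g)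
    (h : ∀ a b, f (ofTensor k A A (a ⊗ₜ b)) = g (ofTensor k A A (a ⊗ₜ b)))
    (x : CompletedTensor k A A) : f x = g x := by
  refine congrFun (denseRange_ofTensor.equalizer hf hg (funext fun x => ?_)) x
  simp only [Function.comp_apply]
  induction x with
  | zero => simp
  | tmul a b => exact h a b
  | add x y hx hy => simp only [map_add, hx, hy]

end CompletedTensor

/-! ### Separability idempotents, derivations and projectivity -/

section

variable {k : Type v} {A : Type u} [Field k] [Ring A] [Algebra k A]
  [TopologicalSpace A] [hA : IsPseudocompactAlgebra k A]

open CompletedTensor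

section Extension

variable {T : Type*} [AddCommGroup T] [Module k T] [Module A T] [Module Aᵐᵒᵖ T]
  [IsScalarTower k A T] [IsScalarTower k Aᵐᵒᵖ T] [SMulCommClass A Aᵐᵒᵖ T]
  [TopologicalSpace T]

theorem extension_op_smul (hT : IsPseudocompactBimodule k A T) {d : A →L[k] T}
    {Φ : CompletedTensor k A A →L[k] T}
    (hΦ : ∀ x, Φ (ofTensor k A A x) = IsPseudocompactBimodule.rightMul d x) (a : A)
    (x : CompletedTensor k A A) : Φ (op a • x) = op a • Φ x := by
  have := hT.t2Space
  have := hT.continuousSMul_right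
  have := (isPseudocompactBimodule k A).continuousSMul_right
  refine eq_of_forall_tmul ((Φ : _ →+ T).comp (DistribSMul.toAddMonoidHom _ (op a)))
    ((DistribSMul.toAddMonoidHom T (op a)).comp (Φ : _ →+ T))
    (Φ.continuous.comp (continuous_const_smul _)) (Φ.continuous.const_smul _) (fun b c => ?_) x
  change Φ (op a • ofTensor k A A (b ⊗ₜ c)) = op a • Φ (ofTensor k A A (b ⊗ₜ c))
  rw [op_smul_ofTensor_tmul, hΦ, hΦ, IsPseudocompactBimodule.rightMul_tmul,
    IsPseudocompactBimodule.rightMul_tmul, op_mul, mul_smul]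

/-- On pure tensors this is the Leibniz rule `d(ab) c = a d(b) c + d(a) bc`; density and continuity
do the rest. The last term measures the failure of left linearity. -/
theorem extension_smul_of_isDerivation (hT : IsPseudocompactBimodule k A T) {d : A →L[k] T}
    (hd : IsDerivation d) {Φ : CompletedTensor k A A →L[k] T}
    (hΦ : ∀ x, Φ (ofTensor k A A x) = IsPseudocompactBimodule.rightMul d x) (a : A)
    (x : CompletedTensor k A A) : Φ (a • x) = a • Φ x + op (mulMap k A x) • d a := by
  have := hT.t2Space
  have := hT.isTopologicalAddGroup
  have := hT.continuousSMul_right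
  have := hT.continuousSMul_left
  have := (isPseudocompactBimodule k A).continuousSMul_left
  refine eq_of_forall_tmul ((Φ : _ →+ T).comp (DistribSMul.toAddMonoidHom _ a))
    ((DistribSMul.toAddMonoidHom T a).comp (Φ : _ →+ T) +
      (AddMonoidHom.flip (smulAddHom Aᵐᵒᵖ T) (d a)).comp
        (opAddEquiv.toAddMonoidHom.comp (mulMap k A : _ →+ A)))
    (Φ.continuous.comp (continuous_const_smul _)) ((Φ.continuous.const_smul _).add
      ((continuous_op.comp (mulMap k A).continuous).smul continuous_const)) (fun b c => ?_) x
  change Φ (a • ofTensor k A A (b ⊗ₜ c)) = a • Φ (ofTensor k A A (b ⊗ₜ c)) +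
    op (mulMap k A (ofTensor k A A (b ⊗ₜ c))) • d a
  rw [smul_ofTensor_tmul, hΦ, hΦ, IsPseudocompactBimodule.rightMul_tmul,
    IsPseudocompactBimodule.rightMul_tmul, mulMap_ofTensor, LinearMap.mul'_apply, hd, smul_add,
    op_mul, mul_smul, smul_comm a (op c)]

theorem extension_smul (hT : IsPseudocompactBimodule k A T) {d : A →L[k] T}
    (hd : ∀ a b, d (a * b) = a • d b) {Φ : CompletedTensor k A A →L[k] T}
    (hΦ : ∀ x, Φ (ofTensor k A A x) = IsPseudocompactBimodule.rightMul d x) (a : A)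
    (x : CompletedTensor k A A) : Φ (a • x) = a • Φ x := by
  have := hT.t2Space
  have := hT.continuousSMul_left
  have := (isPseudocompactBimodule k A).continuousSMul_left
  refine eq_of_forall_tmul ((Φ : _ →+ T).comp (DistribSMul.toAddMonoidHom _ a))
    ((DistribSMul.toAddMonoidHom T a).comp (Φ : _ →+ T))
    (Φ.continuous.comp (continuous_const_smul _)) (Φ.continuous.const_smul _) (fun b c => ?_) x
  change Φ (a • ofTensor k A A (b ⊗ₜ c)) = a • Φ (ofTensor k A A (b ⊗ₜ c))
  rw [smul_ofTensor_tmul, hΦ, hΦ, IsPseudocompactBimodule.rightMul_tmul,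
    IsPseudocompactBimodule.rightMul_tmul, hd, smul_comm a (op c)]

end Extension

/-- With `p = ∑ aᵢ ⊗ bᵢ` heuristically, the element `u = Φ p = ∑ d(aᵢ) bᵢ` works: computing `Φ(ap) =
Φ(pa)` in two ways gives `a u + d(a) = u a`. -/
theorem everyDerivationInner_of_separabilityIdempotent
    (h : ∃ p : CompletedTensor k A A, mulMap k A p = 1 ∧ ∀ a : A, a • p = op a • p) :
    EveryDerivationInner k A := by
  obtain ⟨p, hp, hpa⟩ := h
  intro T _ _ _ _ _ _ _ _ hT d hd
  obtain ⟨Φ, hΦ⟩ := hT.exists_completedTensor_map d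
  refine ⟨Φ p, fun a => ?_⟩
  have h1 := extension_smul_of_isDerivation hT hd hΦ a p
  rw [hpa, extension_op_smul hT hΦ, hp, op_one, one_smul] at h1
  rw [h1, add_sub_cancel_left]

/-- Lift `g 1` to any `m`. The map `Φ(b ⊗ c) = b m c` is a bimodule map over `g ∘ mulMap`, and `a ↦
a p` is a bimodule section of `mulMap` because `ap = pa`; the lift is their composite. -/
theorem isProjectiveBimodule_of_separabilityIdempotent
    (h : ∃ p : CompletedTensor k A A, mulMap k A p = 1 ∧ ∀ a : A, a • p = op a • p) :
    IsProjectiveBimodule k A A := by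
  obtain ⟨p, hp, hpa⟩ := h
  intro M N _ _ _ _ _ _ _ _ _ _ _ _ _ _ _ _ hM hN f g hf hg hsurj
  have := hM.continuousSMul_left
  have := hN.t2Space
  have := (isPseudocompactBimodule k A).continuousSMul_left
  obtain ⟨m, hm⟩ := hsurj (g 1)
  let d : A →L[k] M := ⟨(LinearMap.toSpanSingleton A M m).restrictScalars k,
    continuous_id.smul continuous_const⟩
  have hd : ∀ a, d a = a • m := fun a => rfl
  obtain ⟨Φ, hΦ⟩ := hM.exists_completedTensor_map d
  have hΦl := extension_smul hM (fun a b => by rw [hd, hd, mul_smul]) hΦ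
  have hΦr := extension_op_smul hM hΦ
  have hΦf : ∀ x, f (Φ x) = g (mulMap k A x) := by
    refine eq_of_forall_tmul ((f : M →+ N).comp (Φ : CompletedTensor k A A →+ M))
      ((g : A →+ N).comp (mulMap k A : CompletedTensor k A A →+ A))
      (f.continuous.comp Φ.continuous) (g.continuous.comp (mulMap k A).continuous) (fun b c => ?_)
    change f (Φ (ofTensor k A A (b ⊗ₜ c))) = g (mulMap k A (ofTensor k A A (b ⊗ₜ c)))
    rw [hΦ, IsPseudocompactBimodule.rightMul_tmul, mulMap_ofTensor, LinearMap.mul'_apply, hf.2, hd,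
      hf.1, hm, ← hg.1, ← hg.2, smul_eq_mul, mul_one, op_smul_eq_mul]
  let h : A →L[k] M := ⟨Φ.toLinearMap ∘ₗ
    (LinearMap.toSpanSingleton A (CompletedTensor k A A) p).restrictScalars k,
    Φ.continuous.comp (continuous_id.smul continuous_const)⟩
  have hh : ∀ a, h a = Φ (a • p) := fun a => rfl
  refine ⟨h, ⟨fun a x => ?_, fun a x => ?_⟩, fun a => ?_⟩
  · rw [hh, hh, smul_eq_mul, mul_smul, hΦl]
  · rw [hh, hh, op_smul_eq_mul, mul_smul, hpa, smul_comm, hΦr]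
  · rw [hh, hΦf, (isBimoduleHom_mulMap k A).1, hp, smul_eq_mul, mul_one]

theorem exists_section_mulMap_of_isProjectiveBimodule (h : IsProjectiveBimodule k A A)
    (hA' : IsPseudocompactBimodule k A A) :
    ∃ γ : A →L[k] CompletedTensor k A A, IsBimoduleHom A γ ∧ ∀ a, mulMap k A (γ a) = a := by
  refine h (CompletedTensor k A A) A (isPseudocompactBimodule k A) hA' (mulMap k A)
    (ContinuousLinearMap.id k A) (isBimoduleHom_mulMap k A) ⟨fun a x => rfl, fun a x => rfl⟩
    (mulMap_surjective k A)

theorem exists_separabilityIdempotent_of_section_mulMap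
    (h : ∃ γ : A →L[k] CompletedTensor k A A, IsBimoduleHom A γ ∧ ∀ a, mulMap k A (γ a) = a) :
    ∃ p : CompletedTensor k A A, mulMap k A p = 1 ∧ ∀ a : A, a • p = op a • p := by
  obtain ⟨γ, hγ, h⟩ := h
  refine ⟨γ 1, h 1, fun a => ?_⟩
  rw [← hγ.1, ← hγ.2, smul_eq_mul, op_smul_eq_mul, mul_one, one_mul]

variable (k A) in
/-- A pseudocompact algebra is a pseudocompact bimodule over itself. -/
theorem IsPseudocompactAlgebra.isPseudocompactBimodule : IsPseudocompactBimodule k A A where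
  isTopologicalAddGroup := hA.isTopologicalRing.to_topologicalAddGroup
  continuousSMul_left := by
    have := hA.isTopologicalRing
    infer_instance
  continuousSMul_right := by
    have := hA.isTopologicalRing
    infer_instance
  t2Space := hA.t2Space
  completeSpace := hA.completeSpace
  hasBasis := hA.hasBasis.to_hasBasis
    (fun I hI => ⟨I.restrictScalars k, ⟨hI.2.1, fun a x hx => I.mul_mem_left a hx,
      fun a x hx => have := hI.1; I.mul_mem_right a hx, hI.2.2⟩, subset_rfl⟩)
    (fun N hN => by
      obtain ⟨I, hI, h⟩ := hA.hasBasis.mem_iff.1 (hN.1.mem_nhds (zero_mem N))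
      exact ⟨I, hI, h⟩)

namespace KerMul

instance : IsScalarTower k A (KerMul k A) :=
  ⟨fun c a x => Subtype.ext (smul_assoc c a x.1)⟩

instance : IsScalarTower k Aᵐᵒᵖ (KerMul k A) :=
  ⟨fun c a x => Subtype.ext (smul_assoc c a x.1)⟩

instance : SMulCommClass A Aᵐᵒᵖ (KerMul k A) :=
  ⟨fun a b x => Subtype.ext (smul_comm a b x.1)⟩

-- This makes the universal derivation an admissible test case for innerness. Completeness comes
-- from the kernel being closed; finite codimension comes from embedding the quotient of the kernel
-- by its intersection with `N` into the quotient by `N`.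
variable (k A) in
theorem isPseudocompactBimodule : IsPseudocompactBimodule k A (KerMul k A) where
  isTopologicalAddGroup := inferInstance
  continuousSMul_left := by
    have := (CompletedTensor.isPseudocompactBimodule k A).continuousSMul_left
    exact ⟨(continuous_fst.smul (continuous_subtype_val.comp continuous_snd)).subtype_mk _⟩
  continuousSMul_right := by
    have := (CompletedTensor.isPseudocompactBimodule k A).continuousSMul_right
    exact ⟨(continuous_fst.smul (continuous_subtype_val.comp continuous_snd)).subtype_mk _⟩
  t2Space := inferInstance
  completeSpace := by
    have := hA.t2Space
    let u := IsTopologicalAddGroup.rightUniformSpace (CompletedTensor k A A)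
    have : IsUniformAddGroup (CompletedTensor k A A) := isUniformAddGroup_of_addCommGroup
    have : CompleteSpace (CompletedTensor k A A) :=
      (CompletedTensor.isPseudocompactBimodule k A).completeSpace
    have hc : IsClosed ((LinearMap.ker (mulMap k A).toLinearMap : Set (CompletedTensor k A A))) :=
      isClosed_singleton.preimage (mulMap k A).continuous
    have : IsUniformAddGroup (KerMul k A) :=
      IsUniformAddGroup.comap (LinearMap.ker (mulMap k A).toLinearMap).subtype
    have h := hc.completeSpace_coe
    rwa [← IsUniformAddGroup.rightUniformSpace_eq (G := KerMul k A)] at h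
  hasBasis := by
    have h := (CompletedTensor.isPseudocompactBimodule k A).hasBasis
    have h2 := h.comap (Subtype.val : KerMul k A → CompletedTensor k A A)
    have h0 : 𝓝 (0 : KerMul k A) = comap Subtype.val (𝓝 0) := nhds_subtype _ _
    rw [h0]
    refine h2.to_hasBasis (fun N hN => ⟨N.comap (LinearMap.ker (mulMap k A).toLinearMap).subtype,
      ⟨hN.1.preimage continuous_subtype_val, fun a x hx => hN.2.1 a _ hx,
        fun a x hx => hN.2.2.1 a _ hx, ?_⟩, subset_rfl⟩) (fun N hN => ?_)
    · have := hN.2.2.2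
      exact Module.Finite.of_injective (Submodule.mapQ _ N
        (LinearMap.ker (mulMap k A).toLinearMap).subtype le_rfl) (by
          rw [← LinearMap.ker_eq_bot, Submodule.ker_mapQ, Submodule.mkQ_map_self])
    · have := hN.1.mem_nhds (zero_mem N)
      rw [h0, h2.mem_iff] at this
      exact this

end KerMul

/-- The element `p = 1 ⊗ 1 - u` has `m(p) = 1` as `u` lies in the kernel, and `1 ⊗ a - a ⊗ 1 = ua -
au` rearranges to `ap = pa`. -/
theorem exists_separabilityIdempotent_of_isInnerDerivation
    (h : IsInnerDerivation (universalDerivation k A)) :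
    ∃ p : CompletedTensor k A A, mulMap k A p = 1 ∧ ∀ a : A, a • p = op a • p := by
  obtain ⟨u, hu⟩ := h
  have h1 := mulMap_inl_mul_inr k A 1 1
  have hu0 : mulMap k A u.1 = 0 := u.2
  rw [map_one, map_one, mul_one, mul_one] at h1
  refine ⟨1 - u.1, by rw [map_sub, h1, hu0, sub_zero], fun a => ?_⟩
  have h2 : inr k A A a - inl k A A a = op a • u.1 - a • u.1 := congrArg Subtype.val (hu a)
  rw [smul_sub, smul_sub, smul_def a 1, op_smul_def a 1, one_mul, mul_one,
    sub_eq_iff_eq_add.1 h2]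
  abel

end

end Bimodule

/-! ### Separability idempotents -/

/-- `p ∈ B ⊗ B` with `m(p) = 1` and `ap = pa` for all `a`. -/
def HasSeparabilityIdempotent (k B : Type*) [CommRing k] [Ring B] [Algebra k B] : Prop :=
  ∃ p : B ⊗[k] B, LinearMap.mul' k B p = 1 ∧ ∀ a : B, (a ⊗ₜ 1) * p = p * (1 ⊗ₜ a)

namespace HasSeparabilityIdempotent

section

variable {k : Type*} [CommRing k]

theorem of_surjective {B C : Type*} [Ring B] [Algebra k B] [Ring C] [Algebra k C]
    (h : HasSeparabilityIdempotent k B) (f : B →ₐ[k] C) (hf : Function.Surjective f) :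
    HasSeparabilityIdempotent k C := by
  obtain ⟨p, hp, hpa⟩ := h
  refine ⟨Algebra.TensorProduct.map f f p, ?_, fun c => ?_⟩
  · have key : ∀ x, LinearMap.mul' k C (Algebra.TensorProduct.map f f x) =
        f (LinearMap.mul' k B x) := fun x => by
      induction x with
      | zero => simp
      | tmul a b => simp
      | add x y hx hy => simp only [map_add, hx, hy]
    rw [key, hp, map_one]
  · obtain ⟨b, rfl⟩ := hf c
    simpa using congrArg (Algebra.TensorProduct.map f f) (hpa b)

theorem pi {ι : Type*} [Finite ι] {B : ι → Type*} [∀ i, Ring (B i)] [∀ i, Algebra k (B i)]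
    (h : ∀ i, HasSeparabilityIdempotent k (B i)) : HasSeparabilityIdempotent k (∀ i, B i) := by
  classical
  have := Fintype.ofFinite ι
  choose p hp hpa using h
  let s : ∀ i, B i →ₗ[k] ∀ i, B i := fun i => LinearMap.single k B i
  refine ⟨∑ i, TensorProduct.map (s i) (s i) (p i), ?_, fun a => ?_⟩
  · have key : ∀ i x, LinearMap.mul' k _ (TensorProduct.map (s i) (s i) x) =
        s i (LinearMap.mul' k (B i) x) := fun i x => by
      induction x with
      | zero => simp
      | tmul a b => simp [s, Pi.single_mul]
      | add x y hx hy => simp only [map_add, hx, hy]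
    rw [map_sum]
    simp_rw [key, hp]
    exact Finset.univ_sum_single (1 : ∀ i, B i)
  · rw [Finset.mul_sum, Finset.sum_mul]
    refine Finset.sum_congr rfl fun i _ => ?_
    have h1 : ∀ x, (a ⊗ₜ 1) * TensorProduct.map (s i) (s i) x =
        TensorProduct.map (s i) (s i) ((a i ⊗ₜ 1) * x) := fun x => by
      induction x with
      | zero => simp
      | tmul b c =>
        have : a * Pi.single i b = Pi.single i (a i * b) := by
          ext j
          by_cases hj : j = i
          · subst hj; simp
          · simp [hj]
        simp [s, this]
      | add x y hx hy => simp only [map_add, mul_add, hx, hy]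
    have h2 : ∀ x, TensorProduct.map (s i) (s i) x * (1 ⊗ₜ a) =
        TensorProduct.map (s i) (s i) (x * (1 ⊗ₜ a i)) := fun x => by
      induction x with
      | zero => simp
      | tmul b c =>
        have : Pi.single i c * a = Pi.single i (c * a i) := by
          ext j
          by_cases hj : j = i
          · subst hj; simp
          · simp [hj]
        simp [s, this]
      | add x y hx hy => simp only [map_add, add_mul, hx, hy]
    rw [h1, h2, hpa]

/-- The element is `∑ᵢ eᵢₒ p eₒᵢ` for one fixed index `o`; fixing `o` instead of summing over it
avoids dividing by the size of the matrices. -/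
theorem matrix {n : Type*} [Fintype n] [DecidableEq n] [Nonempty n] {D : Type*} [Ring D]
    [Algebra k D] (h : HasSeparabilityIdempotent k D) :
    HasSeparabilityIdempotent k (Matrix n n D) := by
  obtain ⟨p, hp, hpa⟩ := h
  let o : n := Classical.arbitrary n
  let s : n → n → D →ₗ[k] Matrix n n D := fun i j => Matrix.singleLinearMap k i j
  have hs : ∀ i j x, s i j x = Matrix.single i j x := fun i j x => rfl
  refine ⟨∑ i, TensorProduct.map (s i o) (s o i) p, ?_, fun a => ?_⟩
  · have key : ∀ i x, LinearMap.mul' k _ (TensorProduct.map (s i o) (s o i) x) =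
        s i i (LinearMap.mul' k D x) := fun i x => by
      induction x with
      | zero => simp
      | tmul a b => simp [hs]
      | add x y hx hy => simp only [map_add, hx, hy]
    rw [map_sum]
    simp_rw [key, hp, hs]
    exact Matrix.sum_single_one
  · have h1 : ∀ i r t (b : D) x, (Matrix.single r t b ⊗ₜ 1) * TensorProduct.map (s i o) (s o i) x =
        if t = i then TensorProduct.map (s r o) (s o t) ((b ⊗ₜ 1) * x) else 0 := fun i r t b x => by
      induction x with
      | zero => simp
      | tmul c d =>
        split_ifs with hti
        · subst hti; simp [hs]
        · simp [hs, Matrix.single_mul_single_of_ne _ _ _ _ hti]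
      | add x y hx hy => simp only [map_add, mul_add, hx, hy]; split_ifs <;> simp
    have h2 : ∀ i r t (b : D) x, TensorProduct.map (s i o) (s o i) x * (1 ⊗ₜ Matrix.single r t b) =
        if i = r then TensorProduct.map (s r o) (s o t) (x * (1 ⊗ₜ b)) else 0 := fun i r t b x => by
      induction x with
      | zero => simp
      | tmul c d =>
        split_ifs with hti
        · subst hti; simp [hs]
        · simp [hs, Matrix.single_mul_single_of_ne _ _ _ _ hti]
      | add x y hx hy => simp only [map_add, add_mul, hx, hy]; split_ifs <;> simp
    induction a using Matrix.induction_on with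
    | h_add x y hx hy =>
      rw [TensorProduct.add_tmul, TensorProduct.tmul_add, add_mul, mul_add, hx, hy]
    | h_std_basis r t b =>
      rw [Finset.mul_sum, Finset.sum_mul]
      simp_rw [h1, h2, hpa]
      simp

end

section

variable {k : Type*} [Field k] {B C : Type*} [Ring B] [Algebra k B] [Ring C] [Algebra k C]

/-- Maschke's averaging argument: a left ideal is a `C`-direct summand since `C` is semisimple, and
averaging a `C`-linear projection over the separability idempotent makes it linear over `B` too. -/
theorem isSemisimpleRing_tensor_left (h : HasSeparabilityIdempotent k B) [IsSemisimpleRing C] :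
    IsSemisimpleRing (C ⊗[k] B) := by
  obtain ⟨p, hp, hpa⟩ := h
  have hsmul : ∀ (c : C) (x : C ⊗[k] B), c • x = (c ⊗ₜ 1) * x := fun c x => by
    induction x with
    | zero => simp
    | tmul d b => simp [TensorProduct.smul_tmul']
    | add x y hx hy => rw [smul_add, mul_add, hx, hy]
  refine (isSemisimpleModule_iff _ _).2 ⟨fun L => ?_⟩
  let L' : Submodule C (C ⊗[k] B) :=
    { L.toAddSubmonoid with
      smul_mem' := fun c x hx => by
        rw [hsmul]
        exact L.smul_mem _ hx }
  obtain ⟨M, hM⟩ := exists_isCompl L'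
  let π : C ⊗[k] B →ₗ[C] C ⊗[k] B := L'.projection M hM
  have hπL : ∀ x, π x ∈ L := fun x => Submodule.projection_apply_mem hM x
  have hπ : ∀ x ∈ L, π x = x := fun x hx => Submodule.projection_apply_of_mem_left hM hx
  let l : B →ₗ[k] Module.End k (C ⊗[k] B) :=
    (Algebra.lmul k (C ⊗[k] B)).toLinearMap ∘ₗ Algebra.TensorProduct.includeRight.toLinearMap
  have hl : ∀ b x, l b x = (1 ⊗ₜ b) * x := fun b x => rfl
  -- For `q = ∑ bᵢ ⊗ cᵢ` this is the average `x ↦ ∑ bᵢ π(cᵢ x)`. It is `C`-linear and lands in `L`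
  -- for every `q`; it restricts to the identity of `L` when `m(q) = 1`.
  let Ψ : B ⊗[k] B →ₗ[k] Module.End k (C ⊗[k] B) :=
    TensorProduct.lift (LinearMap.mk₂ k (fun b c => l b * π.restrictScalars k * l c)
      (fun b b' c => by simp only [map_add, add_mul])
      (fun r b c => by simp only [map_smul, smul_mul_assoc])
      (fun b c c' => by simp only [map_add, mul_add])
      (fun r b c => by simp only [map_smul, mul_smul_comm]))
  have hΨ : ∀ b c x, Ψ (b ⊗ₜ c) x = (1 ⊗ₜ b) * π ((1 ⊗ₜ c) * x) := fun b c x => rfl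
  have hΨL : ∀ q x, Ψ q x ∈ L := fun q x => by
    induction q with
    | zero => simp
    | tmul b c => rw [hΨ]; exact L.smul_mem _ (hπL _)
    | add q r hq hr => rw [map_add, LinearMap.add_apply]; exact L.add_mem hq hr
  have hΨid : ∀ q, ∀ x ∈ L, Ψ q x = (1 ⊗ₜ LinearMap.mul' k B q) * x := fun q x hx => by
    induction q with
    | zero => simp
    | tmul b c => rw [hΨ, hπ ((1 ⊗ₜ c) * x) (L.smul_mem _ hx), ← mul_assoc]; simp
    | add q r hq hr => simp only [map_add, LinearMap.add_apply, hq, hr, tmul_add, add_mul]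
  have hΨC : ∀ q c x, Ψ q ((c ⊗ₜ 1) * x) = (c ⊗ₜ 1) * Ψ q x := fun q c x => by
    induction q with
    | zero => simp
    | tmul a b =>
      have hc : ∀ (a : B) (y : C ⊗[k] B), (1 ⊗ₜ a) * ((c ⊗ₜ 1) * y) = (c ⊗ₜ 1) * ((1 ⊗ₜ a) * y) :=
        fun a y => by rw [← mul_assoc, ← mul_assoc]; simp
      rw [hΨ, hΨ, hc, ← hsmul, map_smul, hsmul, hc]
    | add q r hq hr => simp only [map_add, LinearMap.add_apply, hq, hr, mul_add]
  -- The only place where `ap = pa` enters.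
  have hΨB : ∀ a x, Ψ p ((1 ⊗ₜ a) * x) = (1 ⊗ₜ a) * Ψ p x := fun a x => by
    have h1 : ∀ q, Ψ q ((1 ⊗ₜ a) * x) = Ψ (q * (1 ⊗ₜ a)) x := fun q => by
      induction q with
      | zero => simp
      | tmul b c => rw [hΨ, ← mul_assoc]; simp [hΨ]
      | add q r hq hr => simp only [map_add, LinearMap.add_apply, hq, hr, add_mul]
    have h2 : ∀ q, (1 ⊗ₜ a) * Ψ q x = Ψ ((a ⊗ₜ 1) * q) x := fun q => by
      induction q with
      | zero => simp
      | tmul b c => rw [hΨ, ← mul_assoc]; simp [hΨ]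
      | add q r hq hr => simp only [map_add, LinearMap.add_apply, hq, hr, mul_add]
    rw [h1, h2, hpa]
  let f : C ⊗[k] B →ₗ[C ⊗[k] B] L :=
    { toFun := fun x => ⟨Ψ p x, hΨL p x⟩
      map_add' := fun x y => Subtype.ext (map_add _ _ _)
      map_smul' := fun r x => Subtype.ext (by
        change Ψ p (r * x) = r * Ψ p x
        induction r with
        | zero => simp
        | tmul c b =>
          have : (c ⊗ₜ b : C ⊗[k] B) = (c ⊗ₜ 1) * (1 ⊗ₜ b) := by simp
          rw [this, mul_assoc, hΨC, hΨB, mul_assoc]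
        | add r s hr hs => rw [add_mul, map_add, hr, hs, add_mul]) }
  exact ⟨_, LinearMap.isCompl_of_proj (f := f) fun x => Subtype.ext (by
    change Ψ p x.1 = x.1
    rw [hΨid p x.1 x.2, hp, ← Algebra.TensorProduct.one_def, one_mul])⟩

/-- The tensor product of a separable algebra and a semisimple algebra is semisimple. -/
theorem isSemisimpleRing_tensor (h : HasSeparabilityIdempotent k B) [IsSemisimpleRing C] :
    IsSemisimpleRing (B ⊗[k] C) :=
  have : IsSemisimpleRing (C ⊗[k] B) := h.isSemisimpleRing_tensor_left
  (Algebra.TensorProduct.comm k C B).toRingEquiv.isSemisimpleRing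

end

end HasSeparabilityIdempotent

/-! ### Separability idempotents of fields and division algebras -/

namespace HasSeparabilityIdempotent

theorem of_isSeparable (k K : Type*) [Field k] [Field K] [Algebra k K]
    [FiniteDimensional k K] [Algebra.IsSeparable k K] : HasSeparabilityIdempotent k K := by
  have := Algebra.FormallyUnramified.of_isSeparable k K
  obtain ⟨t, ht, ht1⟩ := (Algebra.FormallyUnramified.iff_exists_tensorProduct (R := k) (S := K)).1
    inferInstance
  refine ⟨t, ht1, fun a => ?_⟩
  have := ht a
  rw [sub_mul, sub_eq_zero] at this
  rw [← this, mul_comm]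

/-- A finite-dimensional central division algebra has a separability idempotent. -/
theorem of_isCentral (K D : Type*) [Field K] [DivisionRing D] [Algebra K D]
    [FiniteDimensional K D] [Algebra.IsCentral K D] : HasSeparabilityIdempotent K D := by
  -- The map `a ⊗ b ↦ (x ↦ axb)` is shown to be bijective. The idempotent is then the preimage of a
  -- `K`-linear projection of `D` onto its centre.
  let Ψ : D ⊗[K] D →ₗ[K] Module.End K D :=
    TensorProduct.lift (LinearMap.mk₂ K (fun a b => LinearMap.mulLeft K a * LinearMap.mulRight K b)
      (fun a a' b => by ext; simp [add_mul])
      (fun r a b => by ext; simp)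
      (fun a b b' => by ext; simp [mul_add])
      (fun r a b => by ext; simp))
  have hΨ : ∀ a b x, Ψ (a ⊗ₜ b) x = a * (x * b) := fun a b x => rfl
  -- The algebra of operators generated by left and right multiplications is dense.
  let R : Subalgebra K (Module.End K D) := (AlgHom.mulLeftRight K D).range
  have hR : ∀ a b : D, LinearMap.mulLeft K a * LinearMap.mulRight K b ∈ R := fun a b =>
    ⟨a ⊗ₜ op b, by ext; simp [mul_assoc]⟩
  have hRΨ : ∀ r ∈ R, ∃ q, Ψ q = r := by
    rintro _ ⟨q, rfl⟩
    induction q using TensorProduct.induction_on with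
    | zero => exact ⟨0, by simp⟩
    | tmul a b => exact ⟨a ⊗ₜ b.unop, by ext; simp [hΨ, mul_assoc]⟩
    | add x y hx hy =>
      obtain ⟨q, hq⟩ := hx
      obtain ⟨q', hq'⟩ := hy
      exact ⟨q + q', by rw [map_add, hq, hq']; simp⟩
  have hsimple : IsSimpleModule R D := by
    refine isSimpleModule_iff_toSpanSingleton_surjective.2 ⟨inferInstance, fun x hx y => ?_⟩
    refine ⟨⟨_, hR (y * x⁻¹) 1⟩, ?_⟩
    change y * x⁻¹ * (x * 1) = y
    rw [mul_one, inv_mul_cancel_right₀ hx]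
  -- An endomorphism commuting with left and right multiplications is multiplication by `f 1`, which
  -- is central, hence a scalar. So the bicommutant of `R` is all of `End_K D`, and density gives
  -- surjectivity of `Ψ`.
  have hend : ∀ f : Module.End R D, ∃ c : K, ∀ x, f x = c • x := by
    intro f
    have hl : ∀ a b x, f (a * (x * b)) = a * (f x * b) := fun a b x => f.map_smul ⟨_, hR a b⟩ x
    have hf1 : f 1 ∈ Subalgebra.center K D := by
      rw [Subalgebra.mem_center_iff]
      intro a
      have h1 := hl a 1 1
      have h2 := hl 1 a 1
      simp only [mul_one, one_mul] at h1 h2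
      rw [← h1, ← h2]
    obtain ⟨c, hc⟩ := Algebra.IsCentral.mem_center_iff K |>.1 hf1
    refine ⟨c, fun x => ?_⟩
    have h1 := hl x 1 1
    simp only [mul_one] at h1
    rw [h1, hc, Algebra.smul_def, Algebra.commutes]
  have hsurj : Function.Surjective Ψ := by
    classical
    intro τ
    let τ' : Module.End (Module.End R D) D :=
      { toFun := τ
        map_add' := map_add τ
        map_smul' := fun f x => by
          obtain ⟨c, hc⟩ := hend f
          change τ (f x) = f (τ x)
          rw [hc, hc, map_smul] }
    let e := Module.finBasis K D
    obtain ⟨r, hr⟩ := jacobson_density (R := R) τ' (Finset.univ.image e)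
    obtain ⟨q, hq⟩ := hRΨ r.1 r.2
    refine ⟨q, e.ext fun i => ?_⟩
    rw [hq]
    exact (hr (e i) (by simp)).symm
  have hinj : Function.Injective Ψ :=
    (LinearMap.injective_iff_surjective_of_finrank_eq_finrank (by
      rw [Module.finrank_tensorProduct, Module.finrank_linearMap])).2 hsurj
  obtain ⟨τ, hτ⟩ := LinearMap.exists_leftInverse_of_injective (Algebra.linearMap K D)
    (LinearMap.ker_eq_bot.2 (algebraMap K D).injective)
  -- Evaluating at `1` gives `m(q) = 1`. The elements `aq` and `qa` act as `x ↦ a τ(x)` and `x ↦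
  -- τ(x) a`, which agree because `τ(x)` is a scalar.
  obtain ⟨q, hq⟩ := hsurj (Algebra.linearMap K D ∘ₗ τ)
  refine ⟨q, ?_, fun a => hinj (LinearMap.ext fun x => ?_)⟩
  · have h1 : ∀ q, Ψ q 1 = LinearMap.mul' K D q := fun q => by
      induction q with
      | zero => simp
      | tmul b c => simp [hΨ]
      | add x y hx hy => rw [map_add, LinearMap.add_apply, hx, hy, map_add]
    have h2 := LinearMap.congr_fun hτ 1
    simp only [LinearMap.comp_apply, Algebra.linearMap_apply, map_one, LinearMap.id_apply] at h2
    rw [← h1, hq, LinearMap.comp_apply, h2, Algebra.linearMap_apply, map_one]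
  · have h1 : ∀ q, Ψ ((a ⊗ₜ 1) * q) x = a * Ψ q x := fun q => by
      induction q with
      | zero => simp
      | tmul b c => simp [hΨ, mul_assoc]
      | add x y hx hy => simp only [mul_add, map_add, LinearMap.add_apply, hx, hy]
    have h2 : ∀ q, Ψ (q * (1 ⊗ₜ a)) x = Ψ q x * a := fun q => by
      induction q with
      | zero => simp
      | tmul b c => simp [hΨ, mul_assoc]
      | add x y hx hy => simp only [add_mul, map_add, LinearMap.add_apply, hx, hy]
    rw [h1, h2, hq]
    exact (Algebra.commutes (τ x) a).symm

/-- Transitivity of separability. -/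
theorem trans {k K D : Type*} [Field k] [Field K] [Ring D] [Algebra k K] [Algebra k D]
    [Algebra K D] [IsScalarTower k K D] (hK : HasSeparabilityIdempotent k K)
    (hD : HasSeparabilityIdempotent K D) : HasSeparabilityIdempotent k D := by
  obtain ⟨e, he, hea⟩ := hK
  obtain ⟨q, hq, hqa⟩ := hD
  let ι : K ⊗[k] K →ₐ[k] D ⊗[k] D :=
    Algebra.TensorProduct.map (IsScalarTower.toAlgHom k K D) (IsScalarTower.toAlgHom k K D)
  have hι : ∀ c : K, (algebraMap K D c ⊗ₜ 1) * ι e = ι e * (1 ⊗ₜ algebraMap K D c) := fun c => by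
    simpa [ι] using congrArg ι (hea c)
  -- `x ⊗ y ↦ x e y`
  let s : D ⊗[K] D →+ D ⊗[k] D := TensorProduct.liftAddHom
    { toFun := fun x =>
        { toFun := fun y => (x ⊗ₜ 1) * ι e * (1 ⊗ₜ y)
          map_zero' := by simp
          map_add' := fun y z => by rw [tmul_add, mul_add] }
      map_zero' := by ext; simp
      map_add' := fun x y => by ext; simp [add_tmul, add_mul] }
    -- The tensor product is over `K`, so the map must be balanced over `K`: a scalar moves across
    -- the middle factor because `e` commutes with `K`.
    (fun c x y => by
      have h1 : ((c • x) ⊗ₜ 1 : D ⊗[k] D) = (x ⊗ₜ 1) * (algebraMap K D c ⊗ₜ 1) := by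
        simp [Algebra.smul_def, Algebra.commutes]
      have h2 : (1 ⊗ₜ (c • y) : D ⊗[k] D) = (1 ⊗ₜ algebraMap K D c) * (1 ⊗ₜ y) := by
        simp [Algebra.smul_def]
      change ((c • x) ⊗ₜ 1) * ι e * (1 ⊗ₜ y) = (x ⊗ₜ 1) * ι e * (1 ⊗ₜ (c • y))
      rw [h1, h2, mul_assoc (x ⊗ₜ 1), hι]
      simp only [mul_assoc])
  have hs : ∀ x y, s (x ⊗ₜ y) = (x ⊗ₜ 1) * ι e * (1 ⊗ₜ y) := fun x y => rfl
  refine ⟨s q, ?_, fun a => ?_⟩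
  · have h1 : ∀ (z : D ⊗[k] D) (x y : D), LinearMap.mul' k D ((x ⊗ₜ 1) * z * (1 ⊗ₜ y)) =
        x * LinearMap.mul' k D z * y := fun z x y => by
      induction z with
      | zero => simp
      | tmul a b => simp [mul_assoc]
      | add z w hz hw => simp only [mul_add, add_mul, map_add, hz, hw]
    have h2 : ∀ z, LinearMap.mul' k D (ι z) = algebraMap K D (LinearMap.mul' k K z) := fun z => by
      induction z with
      | zero => simp
      | tmul a b => simp [ι]
      | add z w hz hw => simp only [map_add, hz, hw]
    have h3 : ∀ q, LinearMap.mul' k D (s q) = LinearMap.mul' K D q := fun q => by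
      induction q with
      | zero => simp
      | tmul x y => rw [hs, h1, h2, he, map_one, mul_one, LinearMap.mul'_apply]
      | add x y hx hy => simp only [map_add, hx, hy]
    rw [h3, hq]
  · have h1 : ∀ q, s ((a ⊗ₜ 1) * q) = (a ⊗ₜ 1) * s q := fun q => by
      induction q with
      | zero => simp
      | tmul x y =>
        rw [Algebra.TensorProduct.tmul_mul_tmul, one_mul, hs, hs, ← mul_assoc, ← mul_assoc,
          Algebra.TensorProduct.tmul_mul_tmul, one_mul]
      | add x y hx hy => simp only [mul_add, map_add, hx, hy]
    have h2 : ∀ q, s (q * (1 ⊗ₜ a)) = s q * (1 ⊗ₜ a) := fun q => by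
      induction q with
      | zero => simp
      | tmul x y =>
        rw [Algebra.TensorProduct.tmul_mul_tmul, mul_one, hs, hs, mul_assoc _ _ (1 ⊗ₜ a),
          Algebra.TensorProduct.tmul_mul_tmul, one_mul]
      | add x y hx hy => simp only [add_mul, map_add, hx, hy]
    rw [← h1, ← h2, hqa]

/-- A finite-dimensional division algebra with separable centre has a separability idempotent. -/
theorem of_isSeparable_center (k D : Type*) [Field k] [DivisionRing D] [Algebra k D]
    [FiniteDimensional k D]
    [hs : Algebra.IsSeparable k (Subalgebra.center k D)] :
    HasSeparabilityIdempotent k D := by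
  have hf : IsField (Subalgebra.center k D) := isField_of_isIntegral_of_isField' (Field.toIsField k)
  -- The field structure is built on the existing commutative ring structure of the centre, so that
  -- the separability hypothesis applies to it unchanged.
  let iF : Field (Subalgebra.center k D) :=
    { (inferInstance : CommRing (Subalgebra.center k D)) with
      exists_pair_ne := hf.exists_pair_ne
      inv := hf.toField.inv
      mul_inv_cancel := hf.toField.mul_inv_cancel
      inv_zero := hf.toField.inv_zero
      nnqsmul := _
      nnqsmul_def := fun _ _ => rfl
      qsmul := _
      qsmul_def := fun _ _ => rfl }
  let iA : @Algebra (Subalgebra.center k D) D iF.toCommSemiring _ :=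
    (Subalgebra.center k D).val.toRingHom.toAlgebra' fun c x =>
      (Subalgebra.mem_center_iff.1 c.2 x).symm
  have iT : @IsScalarTower k (Subalgebra.center k D) D _ iA.toSMul _ :=
    ⟨fun r c x => smul_mul_assoc r c.1 x⟩
  have hfin : @Module.Finite (Subalgebra.center k D) D _ _ iA.toModule :=
    @Module.Finite.of_restrictScalars_finite k (Subalgebra.center k D) D _ _ _ _ iA.toModule _ iT _
  have hcen : @Algebra.IsCentral (Subalgebra.center k D) _ D _ iA :=
    @Algebra.IsCentral.mk (Subalgebra.center k D) _ D _ iA fun x hx => ⟨⟨x, hx⟩, rfl⟩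
  exact @trans k (Subalgebra.center k D) D _ iF _ _ _ iA iT
    (@of_isSeparable k (Subalgebra.center k D) _ iF _ _ hs)
    (@of_isCentral (Subalgebra.center k D) D iF _ iA hfin hcen)

end HasSeparabilityIdempotent

/-! ### Separability of central elements -/

/-- A semisimple ring has no nonzero central elements of square zero. -/
theorem IsSemisimpleRing.eq_zero_of_sq_eq_zero {R : Type*} [Ring R] [IsSemisimpleRing R] {y : R}
    (hc : ∀ z, z * y = y * z) (hy : y ^ 2 = 0) : y = 0 := by
  obtain ⟨J, hJ⟩ := exists_isCompl (Ideal.span {y})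
  have h1 : (1 : R) ∈ Ideal.span {y} ⊔ J := by rw [hJ.sup_eq_top]; trivial
  obtain ⟨a, ha, j, hj, haj⟩ := Submodule.mem_sup.1 h1
  obtain ⟨b, rfl⟩ := Ideal.mem_span_singleton'.1 ha
  -- From `1 = by + j` one gets `y = yby + yj = by² + yj = yj`, so `y` lies in both the ideal it
  -- generates and its complement.
  have h2 : y = y * j := by
    conv_lhs => rw [← mul_one y, ← haj, mul_add, ← mul_assoc, ← hc b, mul_assoc, ← sq, hy,
      mul_zero, zero_add]
  have h3 : y ∈ J := by rw [h2]; exact J.mul_mem_left y hj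
  exact (Submodule.disjoint_def.1 hJ.disjoint) y (Ideal.mem_span_singleton_self y) h3

/-- If all base changes of `B` to finite extensions of `k` are semisimple, then central elements of
`B` are separable over `k`. -/
theorem separable_minpoly_of_isSemisimpleRing_tensor {k : Type v} {B : Type u} [Field k] [Ring B]
    [Algebra k B] [FiniteDimensional k B]
    (h : ∀ (E : Type v) [Field E] [Algebra k E] [FiniteDimensional k E],
      IsSemisimpleRing (B ⊗[k] E)) {x : B} (hx : x ∈ Subalgebra.center k B) :
    (minpoly k x).Separable := by
  classical
  by_contra hsep
  set f := minpoly k x with hf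
  have hint : IsIntegral k x := Algebra.IsIntegral.isIntegral x
  let E := f.SplittingField
  have hf0 : f.map (algebraMap k E) ≠ 0 := Polynomial.map_ne_zero (minpoly.ne_zero hint)
  obtain ⟨r, g, hg⟩ : ∃ r : E, (Polynomial.X - Polynomial.C r) ^ 2 ∣ f.map (algebraMap k E) := by
    by_contra! hr
    refine hsep ((Polynomial.separable_map (algebraMap k E)).1 ?_)
    refine (Polynomial.nodup_roots_iff_of_splits hf0 (Polynomial.SplittingField.splits f)).1 ?_
    rw [Multiset.nodup_iff_count_le_one]
    intro r
    by_contra! hc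
    rw [Polynomial.count_roots] at hc
    exact hr r ((Polynomial.le_rootMultiplicity_iff hf0).1 hc)
  have := h E
  -- Work in the `E`-algebra `E ⊗ B`.
  have hss : IsSemisimpleRing (E ⊗[k] B) :=
    (Algebra.TensorProduct.comm k B E).toRingEquiv.isSemisimpleRing
  let ξ : E ⊗[k] B := 1 ⊗ₜ x
  -- Here `f = (X - r)² g` over `E`, so `w² = f g` and `w(ξ)` is central of square zero, hence zero.
  -- But `w` is nonzero of degree less than that of `f`, while the powers of `ξ` below that degree
  -- stay independent over `E`.
  let w : Polynomial E := (Polynomial.X - Polynomial.C r) * g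
  have hcomm : ∀ z, z * Polynomial.aeval ξ w = Polynomial.aeval ξ w * z := by
    have hξ : ξ ∈ Subalgebra.center E (E ⊗[k] B) := by
      rw [Subalgebra.mem_center_iff]
      intro z
      induction z with
      | zero => simp
      | tmul a b => simp [ξ, Subalgebra.mem_center_iff.1 hx b]
      | add z z' hz hz' => rw [add_mul, mul_add, hz, hz']
    exact Subalgebra.mem_center_iff.1 (Algebra.adjoin_le (Set.singleton_subset_iff.2 hξ)
      (Polynomial.aeval_mem_adjoin_singleton E ξ))
  have hsq : (Polynomial.aeval ξ w) ^ 2 = 0 := by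
    have h1 : w ^ 2 = f.map (algebraMap k E) * g := by rw [hg]; ring
    have h2 : Polynomial.aeval ξ f = (1 : E) ⊗ₜ[k] Polynomial.aeval x f :=
      Polynomial.aeval_algHom_apply
        (Algebra.TensorProduct.includeRight : B →ₐ[k] E ⊗[k] B) x f
    rw [← map_pow, h1, map_mul, Polynomial.aeval_map_algebraMap, h2, minpoly.aeval, tmul_zero,
      zero_mul]
  have h0 := IsSemisimpleRing.eq_zero_of_sq_eq_zero hcomm hsq
  have hw0 : w ≠ 0 := by
    intro hw
    rw [hg, sq, mul_assoc] at hf0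
    exact hf0 (by rw [show (Polynomial.X - Polynomial.C r) * g = 0 from hw, mul_zero])
  have hdeg : w.natDegree < f.natDegree := by
    have h1 : f.map (algebraMap k E) = (Polynomial.X - Polynomial.C r) * w := by rw [hg]; ring
    rw [← Polynomial.natDegree_map (algebraMap k E), h1,
      Polynomial.natDegree_mul (Polynomial.X_sub_C_ne_zero r) hw0, Polynomial.natDegree_X_sub_C]
    omega
  have hli := Module.Flat.linearIndependent_one_tmul (S := E) (linearIndependent_pow (K := k) x)
  rw [Fintype.linearIndependent_iff] at hli
  refine hw0 (Polynomial.ext fun n => ?_)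
  by_cases hn : n < f.natDegree
  · refine hli (fun i => w.coeff i) ?_ ⟨n, hn⟩
    rw [← h0, Polynomial.aeval_eq_sum_range' hdeg, ← Fin.sum_univ_eq_sum_range
      (fun i => w.coeff i • ξ ^ i)]
    refine Finset.sum_congr rfl fun i _ => ?_
    rw [Algebra.TensorProduct.tmul_pow, one_pow]
  · exact Polynomial.coeff_eq_zero_of_natDegree_lt (by omega)

/-! ### Base change and Wedderburn decompositions -/

/-- All base changes of `B` to finite extensions of `k` are semisimple. -/
def HasSemisimpleBaseChanges (k : Type v) (B : Type u) [Field k] [Ring B] [Algebra k B] : Prop :=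
  ∀ (E : Type v) [Field E] [Algebra k E] [FiniteDimensional k E], IsSemisimpleRing (B ⊗[k] E)

namespace HasSemisimpleBaseChanges

variable {k : Type v} [Field k] {B : Type*} [Ring B] [Algebra k B]

theorem of_surjective {C : Type*} [Ring C] [Algebra k C] (h : HasSemisimpleBaseChanges k B)
    (f : B →ₐ[k] C) (hf : Function.Surjective f) : HasSemisimpleBaseChanges k C := by
  intro E _ _ _
  have := h E
  exact RingHom.isSemisimpleRing_of_surjective
    (Algebra.TensorProduct.map f (AlgHom.id k E)).toRingHom
    (TensorProduct.map_surjective hf Function.surjective_id)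

/-- A central element of `D` gives a central scalar matrix with the same minimal polynomial. -/
theorem isSeparable_center {n : ℕ} [NeZero n] {D : Type*} [DivisionRing D] [Algebra k D]
    [FiniteDimensional k D] (h : HasSemisimpleBaseChanges k (Matrix (Fin n) (Fin n) D)) :
    Algebra.IsSeparable k (Subalgebra.center k D) := by
  refine ⟨fun c => ?_⟩
  have hc := Subalgebra.mem_center_iff.1 c.2
  have hinj : Function.Injective (Matrix.scalarAlgHom (Fin n) k : D →ₐ[k] _) := fun a b hab => by
    simpa using congrFun (congrFun hab 0) 0
  have h1 : Matrix.scalarAlgHom (Fin n) k c.1 ∈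
      Subalgebra.center k (Matrix (Fin n) (Fin n) D) := by
    rw [Subalgebra.mem_center_iff]
    intro M
    exact (Matrix.scalar_commute c.1 (fun r => (hc r).symm) M).symm
  have h2 := separable_minpoly_of_isSemisimpleRing_tensor h h1
  rw [minpoly.algHom_eq _ hinj] at h2
  rw [IsSeparable, ← minpoly.algHom_eq (Subalgebra.center k D).val Subtype.val_injective]
  exact h2

theorem isSemisimpleRing (h : HasSemisimpleBaseChanges k B) : IsSemisimpleRing B :=
  have := h k
  (Algebra.TensorProduct.rid k k B).toRingEquiv.isSemisimpleRing

/-- Wedderburn's theorem reduces this to matrix algebras. Each factor is a quotient of `B`, so it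
inherits semisimple base changes and its division algebra has separable centre. -/
theorem hasSeparabilityIdempotent [FiniteDimensional k B] (h : HasSemisimpleBaseChanges k B) :
    HasSeparabilityIdempotent k B := by
  have := h.isSemisimpleRing
  obtain ⟨n, D, d, _, _, _, _, ⟨e⟩⟩ :=
    IsSemisimpleRing.exists_algEquiv_pi_matrix_divisionRing_finite k B
  refine HasSeparabilityIdempotent.of_surjective (.pi fun i => ?_) e.symm.toAlgHom e.symm.surjective
  have := (h.of_surjective ((Pi.evalAlgHom k _ i).comp e.toAlgHom)
    ((Function.surjective_eval i).comp e.surjective)).isSeparable_center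
  exact (HasSeparabilityIdempotent.of_isSeparable_center k (D i)).matrix

end HasSemisimpleBaseChanges

theorem HasSeparabilityIdempotent.hasSemisimpleBaseChanges {k : Type v} [Field k] {B : Type*}
    [Ring B] [Algebra k B] (h : HasSeparabilityIdempotent k B) : HasSemisimpleBaseChanges k B :=
  fun _ _ _ _ => h.isSemisimpleRing_tensor

/-! ### Topological semisimplicity -/

/-- The last hypothesis says that `f` is continuous for the discrete topology on `S`, so preimages
of left ideals are closed and have complements. The image of such a complement stays disjoint from
`L`, since the preimage of `L` contains everything mapping into `L`. -/
theorem IsTopologicallySemisimple.isSemisimpleRing_of_surjective {R S : Type*} [Ring R]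
    [TopologicalSpace R] [Ring S] (h : IsTopologicallySemisimple R) (f : R →+* S)
    (hf : Function.Surjective f) (hfc : ∀ s : Set S, IsOpen (f ⁻¹' s)) : IsSemisimpleRing S := by
  refine (isSemisimpleModule_iff _ _).2 ⟨fun L => ?_⟩
  obtain ⟨C, -, hC⟩ := h (Ideal.comap f L) ⟨hfc (L : Set S)ᶜ⟩
  refine ⟨Ideal.map f C, ?_, ?_⟩
  · rw [Submodule.disjoint_def]
    intro x hx hxC
    obtain ⟨c, hc, rfl⟩ := (Ideal.mem_map_iff_of_surjective f hf).1 hxC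
    rw [Submodule.disjoint_def.1 hC.disjoint c hx hc, map_zero]
  · rw [codisjoint_iff, Ideal.eq_top_iff_one]
    have h1 : (1 : R) ∈ Ideal.comap f L ⊔ C := by rw [hC.sup_eq_top]; trivial
    obtain ⟨a, ha, c, hc, hac⟩ := Submodule.mem_sup.1 h1
    rw [← map_one f, ← hac, map_add]
    exact Submodule.add_mem_sup ha (Ideal.mem_map_of_mem f hc)

theorem IsSeparableAlgebra.hasSemisimpleBaseChanges {k : Type v} {A : Type u} [Field k] [Ring A]
    [Algebra k A] [TopologicalSpace A] (h : IsSeparableAlgebra k A) (I : OpenIdeal A) :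
    HasSemisimpleBaseChanges k (A ⧸ I.ideal) := by
  intro E _ _ _
  let : TopologicalSpace E := ⊥
  have : DiscreteTopology E := ⟨rfl⟩
  -- The zero ideal of `E` is open, so `A ⧸ I ⊗ E` is itself one of the discrete quotients of the
  -- completed tensor product.
  let p : OpenIdeal A × OpenIdeal E := (I, ⟨⊥, inferInstance, isOpen_discrete _⟩)
  have : IsSemisimpleRing ((A ⧸ p.1.ideal) ⊗[k] (E ⧸ p.2.ideal)) :=
    (h E).isSemisimpleRing_of_surjective (InverseLimit.proj (quotientTensorMap k A E) p).toRingHom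
      (CompletedTensor.proj_surjective p)
      (InverseLimit.isOpen_preimage_proj (quotientTensorMap k A E) p)
  exact (Algebra.TensorProduct.congr (AlgEquiv.refl : (A ⧸ I.ideal) ≃ₐ[k] _)
    (AlgEquiv.quotientBot k E)).toRingEquiv.isSemisimpleRing

/-- An inverse limit of finite-dimensional semisimple algebras with surjective projections is
topologically semisimple. -/
theorem InverseLimit.isTopologicallySemisimple {k : Type*} [Field k] {ι : Type*} [Preorder ι]
    [Nonempty ι] [IsDirectedOrder ι] {B : ι → Type*} [∀ i, Ring (B i)] [∀ i, Algebra k (B i)]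
    {φ : ∀ ⦃i j : ι⦄, i ≤ j → B j →ₐ[k] B i} (hB : ∀ i, FiniteDimensional k (B i))
    (hss : ∀ i, IsSemisimpleRing (B i)) (hsurj : ∀ i, Function.Surjective (proj φ i)) :
    IsTopologicallySemisimple (InverseLimit φ) := by
  intro L hL
  let R := InverseLimit φ
  -- Closed left ideals `L'` with `L + L' = R`; a minimal one is a complement. The sum condition is
  -- phrased as `L'` meeting the closed affine space `1 + L`, so that linear compactness supplies
  -- lower bounds of chains.
  let S : Set (Ideal R)ᵒᵈ := {L' | IsClosed ((OrderDual.ofDual L' : Ideal R) : Set R) ∧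
    ∃ y ∈ OrderDual.ofDual L', y - 1 ∈ L}
  obtain ⟨L', ⟨hL'c, y, hy, hyL⟩, hmax⟩ : ∃ m, Maximal (· ∈ S) m := by
    refine zorn_le₀ S fun c hcS hc => ?_
    rcases c.eq_empty_or_nonempty with rfl | hne
    · exact ⟨OrderDual.toDual ⊤, ⟨isClosed_univ, 1, trivial, by simp⟩, by simp⟩
    have := hne.to_subtype
    let s : c → AffineSubspace k R := fun J =>
      ((OrderDual.ofDual J.1 : Ideal R).restrictScalars k).toAffineSubspace ⊓
        AffineSubspace.mk' 1 (L.restrictScalars k)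
    have hs : ∀ J x, x ∈ s J ↔ x ∈ OrderDual.ofDual J.1 ∧ x - 1 ∈ L := fun J x => Iff.rfl
    obtain ⟨x, hx⟩ := (isPseudocompactSpace (φ := φ) hB).exists_forall_mem s
      (fun J J' => by
        rcases hc.total J.2 J'.2 with h | h
        · exact ⟨J', fun x hx => ⟨h hx.1, hx.2⟩, le_rfl⟩
        · exact ⟨J, le_rfl, fun x hx => ⟨h hx.1, hx.2⟩⟩)
      (fun J => (hcS J.2).2)
      (fun J => (hcS J.2).1.inter (hL.preimage (continuous_id.sub continuous_const)))
    refine ⟨OrderDual.toDual (⨅ J : c, OrderDual.ofDual J.1), ⟨?_, x, ?_, ?_⟩, fun J hJ => ?_⟩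
    · rw [OrderDual.ofDual_toDual, Submodule.coe_iInf]
      exact isClosed_iInter fun J => (hcS J.2).1
    · exact Submodule.mem_iInf _ |>.2 fun J => (hx J).1
    · exact (hx (Classical.arbitrary _)).2
    · exact iInf_le (fun J : c => OrderDual.ofDual J.1) ⟨J, hJ⟩
  refine ⟨OrderDual.ofDual L', hL'c, ?_, ?_⟩
  · rw [Submodule.disjoint_def]
    intro z hzL hzL'
    refine ext fun i => ?_
    have := hss i
    -- Cutting `L'` by the preimage of `C` keeps `L + L' = R`: the component of `y` outside `C`
    -- lifts to `L ⊓ L'` and can be subtracted. Minimality puts `L'` in that preimage, so the image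
    -- of `L ⊓ L'` in `B i` is disjoint from itself, i.e. zero.
    obtain ⟨C, hC⟩ := exists_isCompl (Ideal.map (proj φ i) (L ⊓ OrderDual.ofDual L'))
    have hz : OrderDual.ofDual L' ≤ OrderDual.ofDual L' ⊓ Ideal.comap (proj φ i) C := @hmax
        (OrderDual.toDual (OrderDual.ofDual L' ⊓ Ideal.comap (proj φ i) C)) (by
      refine ⟨hL'c.inter ⟨isOpen_preimage_proj φ i (C : Set (B i))ᶜ⟩, ?_⟩
      have h1 : proj φ i y ∈ Ideal.map (proj φ i) (L ⊓ OrderDual.ofDual L') ⊔ C := by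
        rw [hC.sup_eq_top]; trivial
      obtain ⟨a, ha, c, hc, hac⟩ := Submodule.mem_sup.1 h1
      obtain ⟨w, hw, rfl⟩ := (Ideal.mem_map_iff_of_surjective _ (hsurj i)).1 ha
      refine ⟨y - w, ⟨sub_mem hy hw.2, ?_⟩, ?_⟩
      · change proj φ i (y - w) ∈ C
        rw [map_sub, ← hac, add_sub_cancel_left]
        exact hc
      · rw [sub_right_comm]
        exact sub_mem hyL hw.1) 
      (show _ ≤ OrderDual.ofDual L' from inf_le_left)
    rw [map_zero]
    exact Submodule.disjoint_def.1 hC.disjoint _ (Ideal.mem_map_of_mem _ ⟨hzL, hzL'⟩) (hz hzL').2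
  · rw [codisjoint_iff, Ideal.eq_top_iff_one]
    have := Submodule.add_mem_sup (neg_mem hyL) hy
    simpa using this

/-! ### Reduction of separability to discrete quotients -/

theorem completeSpace_of_discreteTopology {V : Type*} [AddCommGroup V] [TopologicalSpace V]
    [DiscreteTopology V] [IsTopologicalAddGroup V] :
    letI := IsTopologicalAddGroup.rightUniformSpace V; CompleteSpace V := by
  let := IsTopologicalAddGroup.rightUniformSpace V
  refine ⟨fun {F} hF => ?_⟩
  obtain ⟨hFn, h⟩ := cauchy_rightUniformSpace_iff.1 hF
  obtain ⟨s, hs, h⟩ := h {0} (by simp)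
  obtain ⟨x, hx⟩ := hFn.nonempty_of_mem hs
  refine ⟨x, fun U hU => mem_of_superset hs fun y hy => ?_⟩
  rw [sub_eq_zero.1 (h x hx y hy)]
  exact mem_of_mem_nhds hU

theorem isPseudocompactAlgebra_of_discreteTopology (k B : Type*) [Field k] [Ring B] [Algebra k B]
    [FiniteDimensional k B] [TopologicalSpace B] [DiscreteTopology B] :
    IsPseudocompactAlgebra k B where
  isTopologicalRing := inferInstance
  t2Space := inferInstance
  completeSpace := completeSpace_of_discreteTopology
  hasBasis := by
    rw [nhds_discrete]
    refine (hasBasis_pure (0 : B)).to_hasBasis (fun _ _ => ⟨⊥, ⟨inferInstance, isOpen_discrete _,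
      inferInstance⟩, by simp⟩) (fun I _ => ⟨(), by simp⟩)

theorem isSeparableAlgebra_of_hasSeparabilityIdempotent (k : Type v) (A : Type u) [Field k]
    [Ring A] [Algebra k A] [TopologicalSpace A] [IsPseudocompactAlgebra k A]
    (h : ∀ I : OpenIdeal A, HasSeparabilityIdempotent k (A ⧸ I.ideal)) :
    IsSeparableAlgebra k A := by
  intro E _ _ _ _ _
  have := isPseudocompactAlgebra_of_discreteTopology k E
  refine InverseLimit.isTopologicallySemisimple (fun p => ?_) (fun p => ?_)
    CompletedTensor.proj_surjective
  · have := IsPseudocompactAlgebra.finiteDimensional_quotient k p.1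
    have := IsPseudocompactAlgebra.finiteDimensional_quotient k p.2
    infer_instance
  -- The ideal may be all of `E`, so the quotient is treated as a quotient of a semisimple ring
  -- rather than as a field.
  · have : IsSemisimpleRing (E ⧸ p.2.ideal) :=
      RingHom.isSemisimpleRing_of_surjective _ Ideal.Quotient.mk_surjective
    exact (h p.1).isSemisimpleRing_tensor

/-- A pseudocompact algebra is separable if and only if all its discrete quotients have separability
idempotents. -/
theorem isSeparableAlgebra_iff (k : Type v) (A : Type u) [Field k]
    [Ring A] [Algebra k A] [TopologicalSpace A] [IsPseudocompactAlgebra k A] :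
    IsSeparableAlgebra k A ↔
      ∀ I : OpenIdeal A, HasSeparabilityIdempotent k (A ⧸ I.ideal) :=
  ⟨fun h I =>
    have := IsPseudocompactAlgebra.finiteDimensional_quotient k I
    (h.hasSemisimpleBaseChanges I).hasSeparabilityIdempotent,
    isSeparableAlgebra_of_hasSeparabilityIdempotent k A⟩

theorem HasSeparabilityIdempotent.of_ker_le {k : Type*} [CommRing k] {A C D : Type*} [Ring A]
    [Algebra k A] [Ring C] [Algebra k C] [Ring D] [Algebra k D] (h : HasSeparabilityIdempotent k C)
    (f : A →ₐ[k] C) (hf : Function.Surjective f) (g : A →ₐ[k] D) (hg : Function.Surjective g)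
    (hfg : ∀ a, f a = 0 → g a = 0) : HasSeparabilityIdempotent k D :=
  (h.of_surjective (Ideal.quotientKerAlgEquivOfSurjective hf).symm.toAlgHom
    (AlgEquiv.surjective _)).of_surjective (Ideal.Quotient.liftₐ (RingHom.ker f) g hfg)
    (fun d => by
      obtain ⟨a, rfl⟩ := hg d
      exact ⟨Ideal.Quotient.mk _ a, rfl⟩)

section

variable {k : Type v} {A : Type u} [Field k] [Ring A] [Algebra k A] [TopologicalSpace A]

open CompletedTensor

/-! ### Separability idempotents of the discrete quotients -/

theorem proj_smul (I J : OpenIdeal A) (a : A) (x : CompletedTensor k A A) :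
    InverseLimit.proj (quotientTensorMap k A A) (I, J) (a • x) =
      (Ideal.Quotient.mk I.ideal a ⊗ₜ 1) *
        InverseLimit.proj (quotientTensorMap k A A) (I, J) x := by
  rw [smul_def, map_mul, proj_inl]

theorem proj_op_smul (I J : OpenIdeal A) (a : A) (x : CompletedTensor k A A) :
    InverseLimit.proj (quotientTensorMap k A A) (I, J) (op a • x) =
      InverseLimit.proj (quotientTensorMap k A A) (I, J) x *
        (1 ⊗ₜ Ideal.Quotient.mk J.ideal a) := by
  rw [op_smul_def, map_mul, proj_inr]

variable [hA : IsPseudocompactAlgebra k A]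

theorem hasSeparabilityIdempotent_quotient_of_exists
    (h : ∃ p : CompletedTensor k A A, mulMap k A p = 1 ∧ ∀ a : A, a • p = op a • p)
    (I : OpenIdeal A) : HasSeparabilityIdempotent k (A ⧸ I.ideal) := by
  obtain ⟨p, hp, hpa⟩ := h
  refine ⟨InverseLimit.proj _ (I, I) p, ?_, fun b => ?_⟩
  · have := mk_mulMap k A p I
    rw [hp, map_one] at this
    exact this.symm
  · obtain ⟨a, rfl⟩ := Ideal.Quotient.mk_surjective b
    have := congrArg (InverseLimit.proj _ (I, I)) (hpa a)
    rwa [proj_smul, proj_op_smul] at this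

variable (k) in
/-- The affine space of elements of `A ⊗̂ A` which are separability idempotents modulo `I`. -/
noncomputable def idempotentsModulo (I : OpenIdeal A) :
    AffineSubspace k (CompletedTensor k A A) where
  carrier := {x | Ideal.Quotient.mk I.ideal (mulMap k A x) = 1 ∧
    ∀ a : A, InverseLimit.proj (quotientTensorMap k A A) (I, I) (a • x) =
      InverseLimit.proj (quotientTensorMap k A A) (I, I) (op a • x)}
  smul_vsub_vadd_mem' c x y z hx hy hz := by
    simp only [vsub_eq_sub, vadd_eq_add]
    refine ⟨?_, fun a => ?_⟩
    · have h1 : ∀ c : k, ∀ b : A, Ideal.Quotient.mk I.ideal (c • b) =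
          c • Ideal.Quotient.mk I.ideal b := fun c b => rfl
      rw [map_add, map_smul, map_sub, map_add, h1, map_sub, hx.1, hy.1, hz.1, sub_self, smul_zero,
        zero_add]
    · have hx := hx.2 a
      have hy := hy.2 a
      have hz := hz.2 a
      rw [proj_smul, proj_op_smul] at hx hy hz ⊢
      rw [map_add, map_smul, map_sub, mul_add, add_mul, mul_smul_comm, smul_mul_assoc, mul_sub,
        sub_mul, hx, hy, hz]

theorem mem_idempotentsModulo {I : OpenIdeal A} {x : CompletedTensor k A A} :
    x ∈ idempotentsModulo k I ↔ Ideal.Quotient.mk I.ideal (mulMap k A x) = 1 ∧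
    ∀ a : A, InverseLimit.proj (quotientTensorMap k A A) (I, I) (a • x) =
      InverseLimit.proj (quotientTensorMap k A A) (I, I) (op a • x) := Iff.rfl

/-- Idempotents modulo different `I` cannot simply be chosen compatibly, since they are not unique.
Those modulo `I` form a nonempty closed affine subspace shrinking with `I`, so linear compactness
yields one that works for all `I`. -/
theorem exists_separabilityIdempotent
    (h : ∀ I : OpenIdeal A, HasSeparabilityIdempotent k (A ⧸ I.ideal)) :
    ∃ p : CompletedTensor k A A, mulMap k A p = 1 ∧ ∀ a : A, a • p = op a • p := by
  have hmono : ∀ I J : OpenIdeal A, I ≤ J → idempotentsModulo k J ≤ idempotentsModulo k I := by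
    intro I J hIJ x hx
    refine ⟨?_, fun a => ?_⟩
    · rw [← Ideal.Quotient.factor_mk hIJ, hx.1, map_one]
    · have hp : ((I, I) : OpenIdeal A × OpenIdeal A) ≤ (J, J) := ⟨hIJ, hIJ⟩
      rw [← InverseLimit.proj_compat _ hp, hx.2, InverseLimit.proj_compat]
  have hdir : Directed (· ≥ ·) (idempotentsModulo k (A := A)) := fun I J =>
    let ⟨K, hI, hJ⟩ := exists_ge_ge I J
    ⟨K, hmono I K hI, hmono J K hJ⟩
  have hne : ∀ I : OpenIdeal A, (idempotentsModulo k I : Set (CompletedTensor k A A)).Nonempty := by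
    intro I
    obtain ⟨q, hq, hqa⟩ := h I
    obtain ⟨x, rfl⟩ := proj_surjective (k := k) (I, I) q
    refine ⟨x, (mk_mulMap k A x I).trans hq, fun a => ?_⟩
    rw [proj_smul, proj_op_smul]
    exact hqa _
  have hcl : ∀ I : OpenIdeal A, IsClosed (idempotentsModulo k I : Set (CompletedTensor k A A)) := by
    intro I
    have : (idempotentsModulo k I : Set (CompletedTensor k A A)) =
        InverseLimit.proj (quotientTensorMap k A A) (I, I) ⁻¹' {y | LinearMap.mul' k _ y = 1 ∧
          ∀ a : A, (Ideal.Quotient.mk I.ideal a ⊗ₜ 1) * y =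
            y * (1 ⊗ₜ Ideal.Quotient.mk I.ideal a)} := by
      ext x
      rw [SetLike.mem_coe, mem_idempotentsModulo, mk_mulMap]
      refine and_congr Iff.rfl (forall_congr' fun a => ?_)
      rw [proj_smul, proj_op_smul]
    have h2 : ∀ s : Set ((A ⧸ I.ideal) ⊗[k] (A ⧸ I.ideal)),
        IsClosed (InverseLimit.proj (quotientTensorMap k A A) (I, I) ⁻¹' s) :=
      fun s => ⟨InverseLimit.isOpen_preimage_proj (quotientTensorMap k A A) (I, I) sᶜ⟩
    rw [this]
    exact h2 _
  obtain ⟨p, hp⟩ := (CompletedTensor.isPseudocompactSpace k A A).exists_forall_mem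
    (idempotentsModulo k) hdir hne hcl
  refine ⟨p, IsPseudocompactAlgebra.eq_of_mk_eq k A fun I => by rw [(hp I).1, map_one],
    fun a => InverseLimit.ext fun q => ?_⟩
  -- Diagonal pairs are cofinal among pairs of open ideals, so checking at `(I, I)` is enough.
  obtain ⟨I, h1, h2⟩ := exists_ge_ge q.1 q.2
  have hq : q ≤ (I, I) := ⟨h1, h2⟩
  rw [← InverseLimit.proj_compat _ hq, (hp I).2, InverseLimit.proj_compat]

/-! ### Inverse limits of separable algebras -/

theorem isInverseLimitOfSeparable_of_hasSeparabilityIdempotent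
    (h : ∀ I : OpenIdeal A, HasSeparabilityIdempotent k (A ⧸ I.ideal)) :
    IsInverseLimitOfSeparable k A := by
  have := hA.isTopologicalRing
  let φ : ∀ ⦃I J : OpenIdeal A⦄, I ≤ J → (A ⧸ J.ideal) →ₐ[k] (A ⧸ I.ideal) :=
    fun I J hIJ => Ideal.Quotient.factorₐ k hIJ
  let f : A →ₐ[k] InverseLimit φ := InverseLimit.lift φ (fun I => Ideal.Quotient.mkₐ k I.ideal)
    (fun I J hIJ a => rfl)
  have hf : ∀ I a, InverseLimit.proj φ I (f a) = Ideal.Quotient.mk I.ideal a := fun I a => rfl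
  have hbij : Function.Bijective f := by
    refine ⟨fun a b hab => IsPseudocompactAlgebra.eq_of_mk_eq k A fun I => ?_, fun x => ?_⟩
    · rw [← hf, ← hf, hab]
    · obtain ⟨a, ha⟩ := IsPseudocompactAlgebra.exists_mk_eq k A (fun I => InverseLimit.proj φ I x)
        (fun I J hIJ => InverseLimit.proj_compat x hIJ)
      exact ⟨a, InverseLimit.ext ha⟩
  let e := AlgEquiv.ofBijective f hbij
  have he : ∀ x, f (e.symm x) = x := e.apply_symm_apply
  refine ⟨OpenIdeal A, inferInstance, inferInstance, inferInstance, fun I => A ⧸ I.ideal,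
    fun I => inferInstance, fun I => inferInstance, fun I => ⊥, φ, ⟨fun I x => ?_, ?_⟩, fun I => ?_,
    ⟨{ e with continuous_toFun := ?_, continuous_invFun := ?_ }⟩⟩
  · obtain ⟨a, rfl⟩ := Ideal.Quotient.mk_surjective x
    rfl
  · intro I J K hIJ hJK x
    obtain ⟨a, rfl⟩ := Ideal.Quotient.mk_surjective x
    rfl
  · let : TopologicalSpace (A ⧸ I.ideal) := ⊥
    have hd : DiscreteTopology (A ⧸ I.ideal) := ⟨rfl⟩
    have hfin := IsPseudocompactAlgebra.finiteDimensional_quotient k I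
    have := isPseudocompactAlgebra_of_discreteTopology k (A ⧸ I.ideal)
    exact ⟨hd, hfin, (isSeparableAlgebra_iff k _).2 fun J =>
      (h I).of_surjective (Ideal.Quotient.mkₐ k J.ideal) Ideal.Quotient.mk_surjective⟩
  · refine InverseLimit.continuous_of_isOpen_ker f fun I => ?_
    convert I.isOpen using 1
    ext a
    exact Ideal.Quotient.eq_zero_iff_mem
  · refine continuous_of_continuousAt_zero e.symm fun s hs => ?_
    rw [map_zero] at hs
    rw [mem_map]
    obtain ⟨I, hI⟩ := IsPseudocompactAlgebra.exists_openIdeal k A hs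
    refine mem_of_superset ((InverseLimit.isOpen_ker_proj (φ := φ) I).mem_nhds (zero_mem _))
      fun x hx => hI ?_
    have hx : InverseLimit.proj φ I x = 0 := hx
    rw [← he x, hf] at hx
    exact Ideal.Quotient.eq_zero_iff_mem.1 hx

end

/-! ### Products of discrete spaces -/

theorem exists_finset_of_mem_nhds_zero {ι : Type*} {X : ι → Type*} [∀ i, Zero (X i)]
    [∀ i, TopologicalSpace (X i)] {U : Set (∀ i, X i)} (hU : U ∈ 𝓝 0) :
    ∃ S : Finset ι, ∀ x : ∀ i, X i, (∀ i ∈ S, x i = 0) → x ∈ U := by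
  obtain ⟨V, hVU, hV, h0⟩ := mem_nhds_iff.1 hU
  obtain ⟨S, u, hu, h⟩ := isOpen_pi_iff.1 hV 0 h0
  exact ⟨S, fun x hx => hVU (h fun i hi => by rw [hx i hi]; exact (hu i hi).2)⟩

theorem isOpen_setOf_forall_eq_zero {ι : Type*} {X : ι → Type*} [∀ i, Zero (X i)]
    [∀ i, TopologicalSpace (X i)] [∀ i, DiscreteTopology (X i)] (S : Finset ι) :
    IsOpen {x : ∀ i, X i | ∀ i ∈ S, x i = 0} := by
  have : {x : ∀ i, X i | ∀ i ∈ S, x i = 0} = ⋂ i ∈ S, (fun x => x i) ⁻¹' {0} := by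
    ext x; simp
  rw [this]
  exact isOpen_biInter_finset fun i _ => (isOpen_discrete _).preimage (continuous_apply i)

/-- The ambient space for finding compatible families in an inverse system by linear compactness. -/
theorem IsPseudocompactSpace.pi (k : Type*) [Field k] {ι : Type*} (B : ι → Type*)
    [∀ i, AddCommGroup (B i)] [∀ i, Module k (B i)] [∀ i, TopologicalSpace (B i)]
    [∀ i, DiscreteTopology (B i)] [∀ i, FiniteDimensional k (B i)] :
    IsPseudocompactSpace k (∀ i, B i) where
  isTopologicalAddGroup := inferInstance
  completeSpace := by
    let (i : ι) : UniformSpace (B i) := IsTopologicalAddGroup.rightUniformSpace (B i)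
    have (i : ι) : IsUniformAddGroup (B i) := isUniformAddGroup_of_addCommGroup
    have (i : ι) : CompleteSpace (B i) := completeSpace_of_discreteTopology
    have h : CompleteSpace (∀ i, B i) := inferInstance
    rwa [← IsUniformAddGroup.rightUniformSpace_eq (G := ∀ i, B i)] at h
  hasBasis := by
    refine ⟨fun U => ⟨fun hU => ?_, fun ⟨N, hN, hNU⟩ =>
      mem_of_superset (hN.1.mem_nhds (zero_mem N)) hNU⟩⟩
    obtain ⟨S, hS⟩ := exists_finset_of_mem_nhds_zero hU
    let f : (∀ i, B i) →ₗ[k] ∀ i : S, B i := LinearMap.pi fun i => LinearMap.proj i.1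
    have hf : ∀ x, x ∈ LinearMap.ker f ↔ ∀ i ∈ S, x i = 0 := fun x => by
      rw [LinearMap.mem_ker, funext_iff, Subtype.forall]
      rfl
    refine ⟨LinearMap.ker f, ⟨?_, Module.Finite.equiv f.quotKerEquivRange.symm⟩,
      fun x hx => hS x ((hf x).1 hx)⟩
    rw [show (LinearMap.ker f : Set (∀ i, B i)) = {x | ∀ i ∈ S, x i = 0} from Set.ext hf]
    exact isOpen_setOf_forall_eq_zero S

section

/-! ### Stable images in inverse systems -/

/-- In a directed inverse system of finite-dimensional algebras, the image of the inverse limit in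
each term is the image of some transition map. -/
theorem InverseLimit.exists_range_le {k : Type*} [Field k] {ι : Type*} [Preorder ι]
    [IsDirectedOrder ι] {B : ι → Type*} [∀ i, Ring (B i)] [∀ i, Algebra k (B i)]
    {φ : ∀ ⦃i j : ι⦄, i ≤ j → B j →ₐ[k] B i} (hφ : InverseSystem (fun _ _ h => φ h))
    (hB : ∀ i, FiniteDimensional k (B i)) (i : ι) :
    ∃ (j : ι) (h : i ≤ j), (φ h).range = (proj φ i).range := by
  let r : {j // i ≤ j} → ℕ := fun j => Module.finrank k (φ j.2).range
  obtain ⟨⟨j, hij⟩, -, hmin⟩ := exists_minimalFor_of_wellFoundedLT (fun _ => True) r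
    ⟨⟨i, le_rfl⟩, trivial⟩
  have hcomp : ∀ ⦃a b c : ι⦄ (hab : a ≤ b) (hbc : b ≤ c) (x : B c),
      φ hab (φ hbc x) = φ (hab.trans hbc) x := fun a b c hab hbc x => hφ.map_map hab hbc x
  -- the images of the `B l` with `l ≥ j` agree
  have hstab : ∀ l (hjl : j ≤ l), (φ hij).range = (φ (hij.trans hjl)).range := by
    intro l hjl
    have hle : (φ (hij.trans hjl)).range ≤ (φ hij).range := by
      rintro _ ⟨x, rfl⟩
      exact ⟨φ hjl x, hcomp hij hjl x⟩
    have h1 := hmin (j := ⟨l, hij.trans hjl⟩) trivial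
      (Submodule.finrank_mono (s := Subalgebra.toSubmodule (φ (hij.trans hjl)).range)
        (t := Subalgebra.toSubmodule (φ hij).range) hle)
    exact (Subalgebra.eq_of_le_of_finrank_le hle h1).symm
  refine ⟨j, hij, le_antisymm ?_ ?_⟩
  · intro c hc
    let (l : ι) : TopologicalSpace (B l) := ⊥
    have (l : ι) : DiscreteTopology (B l) := ⟨rfl⟩
    have hps : IsPseudocompactSpace k (∀ l, B l) := .pi k B
    -- Families over `c` whose coordinates below `l` are the images of the `l`-th one. Each is
    -- nonempty because `c` is in the stable image, and a common point is a compatible family over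
    -- `c`.
    let s : {l // j ≤ l} → AffineSubspace k (∀ l, B l) := fun l =>
      { carrier := {x | x i = c ∧ ∀ m (h : m ≤ l.1), φ h (x l.1) = x m}
        smul_vsub_vadd_mem' := fun r x y z hx hy hz => by
          simp only [vsub_eq_sub, vadd_eq_add]
          refine ⟨?_, fun m h => ?_⟩
          · simp [hx.1, hy.1, hz.1]
          · simp [hx.2 m h, hy.2 m h, hz.2 m h] }
    have hs : ∀ l x, x ∈ s l ↔ x i = c ∧ ∀ m (h : m ≤ l.1), φ h (x l.1) = x m :=
      fun l x => Iff.rfl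
    have : Nonempty {l // j ≤ l} := ⟨⟨j, le_rfl⟩⟩
    have hdir : Directed (· ≥ ·) s := fun a b => by
      obtain ⟨l, ha, hb⟩ := exists_ge_ge a.1 b.1
      refine ⟨⟨l, a.2.trans ha⟩, fun x hx => ⟨hx.1, fun m h => ?_⟩,
        fun x hx => ⟨hx.1, fun m h => ?_⟩⟩
      · rw [← hx.2 _ ha, hcomp, hx.2 _ (h.trans ha)]
      · rw [← hx.2 _ hb, hcomp, hx.2 _ (h.trans hb)]
    have hne : ∀ l, (s l : Set (∀ l, B l)).Nonempty := fun l => by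
      classical
      rw [hstab l.1 l.2] at hc
      obtain ⟨y, hy⟩ := hc
      refine ⟨fun m => if h : m ≤ l.1 then φ h y else 0, ?_, fun m h => ?_⟩
      · beta_reduce
        rw [dif_pos (hij.trans l.2)]
        exact hy
      · beta_reduce
        rw [dif_pos le_rfl, dif_pos h, hcomp]
    have hcl : ∀ l, IsClosed (s l : Set (∀ l, B l)) := fun l => by
      have : (s l : Set (∀ l, B l)) = {x | x i = c} ∩
          ⋂ (m) (h : m ≤ l.1), {x | φ h (x l.1) = x m} := by
        ext x
        simp [hs]
      rw [this]
      refine (isClosed_eq (continuous_apply i) continuous_const).inter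
        (isClosed_iInter fun m => isClosed_iInter fun h => ?_)
      exact isClosed_eq (continuous_of_discreteTopology.comp (continuous_apply l.1))
        (continuous_apply m)
    obtain ⟨x, hx⟩ := hps.exists_forall_mem s hdir hne hcl
    refine ⟨⟨x, fun a b hab => ?_⟩, (hx ⟨j, le_rfl⟩).1⟩
    obtain ⟨l, hbl, hjl⟩ := exists_ge_ge b j
    rw [← (hx ⟨l, hjl⟩).2 b hbl, hcomp, (hx ⟨l, hjl⟩).2]
  · rintro _ ⟨x, rfl⟩
    exact ⟨proj φ j x, proj_compat x hij⟩

variable {k : Type v} {A : Type u} [Field k] [Ring A] [Algebra k A] [TopologicalSpace A]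

/-- Transition maps need not be surjective, and subalgebras of separable algebras need not be
separable. The image of `A` in a suitable `B i` is however the full image of some `B j`, hence a
quotient of a separable algebra, and `A ⧸ I` is a quotient of that image. -/
theorem hasSeparabilityIdempotent_quotient_of_isInverseLimit (h : IsInverseLimitOfSeparable k A)
    (I : OpenIdeal A) : HasSeparabilityIdempotent k (A ⧸ I.ideal) := by
  obtain ⟨ι, _, _, _, B, _, _, _, φ, hφ, hB, ⟨e⟩⟩ := h
  have hU : e.symm ⁻¹' (I.ideal : Set A) ∈ 𝓝 (0 : InverseLimit φ) :=
    (I.isOpen.preimage e.symm.continuous).mem_nhds (by simp)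
  obtain ⟨i, -, hi⟩ := InverseLimit.hasBasis_nhds_zero.mem_iff.1 hU
  obtain ⟨j, hij, hrange⟩ := InverseLimit.exists_range_le hφ (fun i => (hB i).2.1) i
  have hBj : HasSeparabilityIdempotent k (B j) := by
    have := (hB j).1
    have := (hB j).2.1
    have := isPseudocompactAlgebra_of_discreteTopology k (B j)
    exact ((isSeparableAlgebra_iff k (B j)).1 (hB j).2.2
      ⟨⊥, inferInstance, isOpen_discrete _⟩).of_ker_le (Ideal.Quotient.mkₐ k ⊥)
      Ideal.Quotient.mk_surjective (AlgHom.id k _) Function.surjective_id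
      fun a ha => Ideal.Quotient.eq_zero_iff_mem.1 ha
  have hr : HasSeparabilityIdempotent k (InverseLimit.proj φ i).range := by
    rw [← hrange]
    exact hBj.of_surjective (φ hij).rangeRestrict (φ hij).rangeRestrict_surjective
  refine hr.of_ker_le (((InverseLimit.proj φ i).rangeRestrict).comp e.toAlgEquiv.toAlgHom)
    ((AlgHom.rangeRestrict_surjective _).comp e.surjective) (Ideal.Quotient.mkₐ k I.ideal)
    Ideal.Quotient.mk_surjective fun a ha => ?_
  have h0 : InverseLimit.proj φ i (e a) = 0 := congrArg Subtype.val ha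
  have := @hi (e a) h0
  refine Ideal.Quotient.eq_zero_iff_mem.2 ?_
  simpa using this

/-! ### Products of matrix algebras -/

/-- An open ideal contains all elements vanishing in finitely many coordinates, so `A ⧸ I` is a
quotient of a finite subproduct. -/
theorem hasSeparabilityIdempotent_quotient_of_isProduct
    (h : IsProductOfSeparableMatrixAlgebras k A) (I : OpenIdeal A) :
    HasSeparabilityIdempotent k (A ⧸ I.ideal) := by
  obtain ⟨ι, n, Δ, _, _, _, hΔ, ⟨e⟩⟩ := h
  have hM : ∀ i, HasSeparabilityIdempotent k (Matrix (Fin (n i)) (Fin (n i)) (Δ i)) := fun i => by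
    have : NeZero (n i) := ⟨(hΔ i).1.ne'⟩
    have := (hΔ i).2.2.1
    have := (hΔ i).2.2.2
    exact (HasSeparabilityIdempotent.of_isSeparable_center k (Δ i)).matrix
  have hU : e.symm ⁻¹' (I.ideal : Set A) ∈ 𝓝 0 :=
    (I.isOpen.preimage e.symm.continuous).mem_nhds (by simp)
  obtain ⟨S, hS⟩ := exists_finset_of_mem_nhds_zero hU
  let r : (∀ i, Matrix (Fin (n i)) (Fin (n i)) (Δ i)) →ₐ[k]
      ∀ i : S, Matrix (Fin (n i)) (Fin (n i)) (Δ i) :=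
    AlgHom.pi fun i => Pi.evalAlgHom k _ i.1
  have hr : Function.Surjective r := fun y => by
    classical
    exact ⟨fun i => if h : i ∈ S then y ⟨i, h⟩ else 0, funext fun i => dif_pos i.2⟩
  refine (HasSeparabilityIdempotent.pi fun i : S => hM i).of_ker_le
    (r.comp e.toAlgEquiv.toAlgHom) (hr.comp e.surjective) (Ideal.Quotient.mkₐ k I.ideal)
    Ideal.Quotient.mk_surjective fun a ha => ?_
  have := hS (e a) fun i hi => congrFun ha ⟨i, hi⟩
  refine Ideal.Quotient.eq_zero_iff_mem.2 ?_
  simpa using this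

end

section

/-! ### Decomposition into matrix algebras -/

variable {k : Type v} {A : Type u} [Field k] [Ring A] [Algebra k A] [TopologicalSpace A]

namespace OpenIdeal

theorem ext_ideal {I J : OpenIdeal A} (h : I.ideal = J.ideal) : I = J := by
  cases I; cases J; congr

/-- Distinct open ideals with simple quotients are comaximal. -/
theorem exists_mem_sub_one_mem {I J : OpenIdeal A} (hI : IsSimpleRing (A ⧸ I.ideal))
    (hJ : IsSimpleRing (A ⧸ J.ideal)) (hne : I ≠ J) : ∃ x ∈ I.ideal, x - 1 ∈ J.ideal := by
  let K := I.ideal ⊔ J.ideal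
  have hK : K.IsTwoSided := ⟨fun b hz => by
    obtain ⟨x, hx, y, hy, rfl⟩ := Submodule.mem_sup.1 hz
    rw [add_mul]
    exact Submodule.add_mem_sup (I.ideal.mul_mem_right b hx) (J.ideal.mul_mem_right b hy)⟩
  -- If `K` is proper, the map from the simple ring `A ⧸ L` to the nonzero `A ⧸ K` is injective, so
  -- `K = L`; applied to `I` and `J`, this would make them equal.
  have key : ∀ L : OpenIdeal A, IsSimpleRing (A ⧸ L.ideal) → L.ideal ≤ K → K ≠ ⊤ →
      K ≤ L.ideal := by
    intro L hL hLK hK1 x hx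
    have : Nontrivial (A ⧸ K) := Ideal.Quotient.nontrivial_iff.2 hK1
    have hinj := RingHom.injective (Ideal.Quotient.factor hLK)
    refine Ideal.Quotient.eq_zero_iff_mem.1 (hinj ?_)
    rw [map_zero, Ideal.Quotient.factor_mk]
    exact Ideal.Quotient.eq_zero_iff_mem.2 hx
  by_cases hK1 : K = ⊤
  · have h1 : (1 : A) ∈ I.ideal ⊔ J.ideal := by
      change 1 ∈ K
      rw [hK1]; trivial
    obtain ⟨x, hx, y, hy, hxy⟩ := Submodule.mem_sup.1 h1
    refine ⟨x, hx, ?_⟩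
    rw [← hxy, sub_add_cancel_left]
    exact neg_mem hy
  · refine absurd (ext_ideal (le_antisymm ?_ ?_)) hne
    · exact le_sup_left.trans (key J hJ le_sup_right hK1)
    · exact le_sup_right.trans (key I hI le_sup_left hK1)

/-- The Chinese remainder theorem for open ideals with simple quotients. -/
theorem exists_forall_sub_mem (S : Finset {I : OpenIdeal A // IsSimpleRing (A ⧸ I.ideal)})
    (c : {I : OpenIdeal A // IsSimpleRing (A ⧸ I.ideal)} → A) :
    ∃ a : A, ∀ I ∈ S, a - c I ∈ I.1.ideal := by
  classical
  -- an element congruent to `1` modulo `J` and to `0` modulo the elements of `S`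
  have hone : ∀ (S : Finset {I : OpenIdeal A // IsSimpleRing (A ⧸ I.ideal)}) (J), J ∉ S →
      ∃ e : A, (∀ I ∈ S, e ∈ I.1.ideal) ∧ e - 1 ∈ J.1.ideal := by
    intro S J
    induction S using Finset.induction_on with
    | empty => exact fun _ => ⟨1, by simp, by simp⟩
    | insert I S _ ih =>
      intro hJ
      rw [Finset.mem_insert, not_or] at hJ
      obtain ⟨e, he, heJ⟩ := ih hJ.2
      obtain ⟨x, hx, hxJ⟩ := exists_mem_sub_one_mem I.2 J.2
        (fun h => hJ.1 (Subtype.ext h.symm))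
      refine ⟨e * x, fun L hL => ?_, ?_⟩
      · rcases Finset.mem_insert.1 hL with rfl | hL
        · exact L.1.ideal.mul_mem_left e hx
        · exact L.1.ideal.mul_mem_right x (he L hL)
      · have : e * x - 1 = e * (x - 1) + (e - 1) := by noncomm_ring
        rw [this]
        exact add_mem (J.1.ideal.mul_mem_left e hxJ) heJ
  induction S using Finset.induction_on with
  | empty => exact ⟨0, by simp⟩
  | insert J S hJ ih =>
    obtain ⟨a, ha⟩ := ih
    obtain ⟨e, he, heJ⟩ := hone S J hJ
    -- As `e` is `1` modulo `J` and `0` modulo `S`, this corrects the residue at `J` without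
    -- disturbing those already right.
    refine ⟨a + (c J - a) * e, fun L hL => ?_⟩
    rcases Finset.mem_insert.1 hL with rfl | hL
    · have : a + (c L - a) * e - c L = (c L - a) * (e - 1) := by noncomm_ring
      rw [this]
      exact L.1.ideal.mul_mem_left _ heJ
    · rw [add_sub_right_comm]
      exact add_mem (ha L hL) (L.1.ideal.mul_mem_left _ (he L hL))

end OpenIdeal

/-- An open ideal with semisimple quotient is a finite intersection of open ideals with simple
quotients. -/
theorem exists_finset_simple [IsTopologicalRing A] (I : OpenIdeal A)
    [IsSemisimpleRing (A ⧸ I.ideal)] :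
    ∃ S : Finset {I : OpenIdeal A // IsSimpleRing (A ⧸ I.ideal)},
      ∀ a : A, (∀ J ∈ S, a ∈ J.1.ideal) → a ∈ I.ideal := by
  classical
  obtain ⟨n, D, d, _, _, ⟨e⟩⟩ :=
    IsSemisimpleRing.exists_ringEquiv_pi_matrix_divisionRing (A ⧸ I.ideal)
  let f : ∀ j, A →+* Matrix (Fin (d j)) (Fin (d j)) (D j) := fun j =>
    (Pi.evalRingHom _ j).comp (e.toRingHom.comp (Ideal.Quotient.mk I.ideal))
  have hf : ∀ j a, f j a = e (Ideal.Quotient.mk I.ideal a) j := fun j a => rfl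
  have hfs : ∀ j, Function.Surjective (f j) := fun j =>
    (Function.surjective_eval j).comp (e.surjective.comp Ideal.Quotient.mk_surjective)
  let J : ∀ j, OpenIdeal A := fun j => ⟨RingHom.ker (f j), inferInstance,
    AddSubgroup.isOpen_mono (H₁ := I.ideal.toAddSubgroup)
      (H₂ := (RingHom.ker (f j)).toAddSubgroup)
      (fun a ha => by
        change f j a = 0
        rw [hf, Ideal.Quotient.eq_zero_iff_mem.2 ha, map_zero, Pi.zero_apply]) I.isOpen⟩
  have hJ : ∀ j, IsSimpleRing (A ⧸ (J j).ideal) := fun j =>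
    IsSimpleRing.of_ringEquiv (RingHom.quotientKerEquivOfSurjective (hfs j)).symm inferInstance
  refine ⟨Finset.univ.image fun j => ⟨J j, hJ j⟩, fun a ha => ?_⟩
  rw [← Ideal.Quotient.eq_zero_iff_mem, ← map_eq_zero_iff e e.injective]
  funext j
  exact ha ⟨J j, hJ j⟩ (Finset.mem_image_of_mem _ (Finset.mem_univ j))

variable [hA : IsPseudocompactAlgebra k A]

/-- The factors are the quotients of `A` by the open ideals with simple quotient. The map to their
product is injective because every open ideal is a finite intersection of such ideals, and
surjective by the Chinese remainder theorem for finite sets of them together with linear compactness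
of `A`. -/
theorem isProductOfSeparableMatrixAlgebras_of_hasSeparabilityIdempotent
    (h : ∀ I : OpenIdeal A, HasSeparabilityIdempotent k (A ⧸ I.ideal)) :
    IsProductOfSeparableMatrixAlgebras k A := by
  have := hA.isTopologicalRing
  let ι := {I : OpenIdeal A // IsSimpleRing (A ⧸ I.ideal)}
  have hfin : ∀ I : OpenIdeal A, FiniteDimensional k (A ⧸ I.ideal) := fun I =>
    IsPseudocompactAlgebra.finiteDimensional_quotient k I
  have hss : ∀ I : OpenIdeal A, IsSemisimpleRing (A ⧸ I.ideal) := fun I =>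
    (h I).hasSemisimpleBaseChanges.isSemisimpleRing
  have hWA : ∀ I : ι, ∃ (n : ℕ) (_ : NeZero n) (D : Type u) (_ : DivisionRing D) (_ : Algebra k D)
      (_ : Module.Finite k D), Nonempty ((A ⧸ I.1.ideal) ≃ₐ[k] Matrix (Fin n) (Fin n) D) := by
    intro I
    have := I.2
    have : IsArtinianRing (A ⧸ I.1.ideal) := inferInstance
    exact IsSimpleRing.exists_algEquiv_matrix_divisionRing_finite k _
  choose n hn Δ _ _ hΔ e using hWA
  replace e := fun I => (e I).some
  let (I : ι) : TopologicalSpace (Δ I) := ⊥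
  have (I : ι) : DiscreteTopology (Δ I) := ⟨rfl⟩
  have (I : ι) : DiscreteTopology (Matrix (Fin (n I)) (Fin (n I)) (Δ I)) :=
    inferInstanceAs (DiscreteTopology (Fin (n I) → Fin (n I) → Δ I))
  have hsep : ∀ I, Algebra.IsSeparable k (Subalgebra.center k (Δ I)) := fun I =>
    ((h I.1).hasSemisimpleBaseChanges.of_surjective (e I).toAlgHom
      (e I).surjective).isSeparable_center
  let f : A →ₐ[k] ∀ I : ι, Matrix (Fin (n I)) (Fin (n I)) (Δ I) :=
    AlgHom.pi fun I => (e I).toAlgHom.comp (Ideal.Quotient.mkₐ k I.1.ideal)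
  have hf : ∀ a I, f a I = e I (Ideal.Quotient.mk I.1.ideal a) := fun a I => rfl
  have hf0 : ∀ a I, f a I = 0 ↔ a ∈ I.1.ideal := fun a I => by
    rw [hf, map_eq_zero_iff _ (e I).injective, Ideal.Quotient.eq_zero_iff_mem]
  have hinj : Function.Injective f := by
    refine (injective_iff_map_eq_zero f).2 fun a ha => ?_
    refine IsPseudocompactAlgebra.eq_of_mk_eq k A fun I => ?_
    obtain ⟨S, hS⟩ := exists_finset_simple I
    rw [map_zero, Ideal.Quotient.eq_zero_iff_mem]
    exact hS a fun J _ => (hf0 a J).1 (congrFun ha J)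
  have hsurj : Function.Surjective f := by
    intro y
    have hc : ∀ I : ι, ∃ c : A, f c I = y I := fun I => by
      obtain ⟨c, hc⟩ := Ideal.Quotient.mk_surjective ((e I).symm (y I))
      exact ⟨c, by rw [hf, hc, AlgEquiv.apply_symm_apply]⟩
    choose c hc using hc
    have hmem : ∀ a I, a - c I ∈ I.1.ideal ↔ f a I = y I := fun a I => by
      rw [← hf0, map_sub, Pi.sub_apply, hc, sub_eq_zero]
    let s : Finset ι → AffineSubspace k A := fun S =>
      { carrier := {a | ∀ I ∈ S, f a I = y I}
        smul_vsub_vadd_mem' := fun r a b c ha hb hc I hI => by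
          simp [ha I hI, hb I hI, hc I hI] }
    have hs : ∀ S a, a ∈ s S ↔ ∀ I ∈ S, f a I = y I := fun S a => Iff.rfl
    have hdir : Directed (· ≥ ·) s := by
      classical
      exact fun S T => ⟨S ∪ T, fun a ha I hI => ha I (Finset.mem_union_left T hI),
        fun a ha I hI => ha I (Finset.mem_union_right S hI)⟩
    have hcl : ∀ S, IsClosed (s S : Set A) := fun S => by
      have : (s S : Set A) = ⋂ I ∈ S, (fun a => a - c I) ⁻¹' (I.1.ideal : Set A) := by
        ext a
        simp [hs, hmem]
      rw [this]
      refine isClosed_biInter fun I _ => IsClosed.preimage (by fun_prop) ?_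
      exact AddSubgroup.isClosed_of_isOpen I.1.ideal.toAddSubgroup I.1.isOpen
    obtain ⟨a, ha⟩ := (IsPseudocompactAlgebra.isPseudocompactSpace k A).exists_forall_mem s hdir
      (fun S => by
        obtain ⟨a, ha⟩ := OpenIdeal.exists_forall_sub_mem S c
        exact ⟨a, fun I hI => (hmem a I).1 (ha I hI)⟩) hcl
    exact ⟨a, funext fun I => (ha {I} I (Finset.mem_singleton_self I))⟩
  let E := AlgEquiv.ofBijective f ⟨hinj, hsurj⟩
  refine ⟨ι, n, Δ, inferInstance, inferInstance, inferInstance,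
    fun I => ⟨Nat.pos_of_ne_zero (hn I).out, inferInstance, hΔ I, hsep I⟩,
    ⟨{ E with continuous_toFun := ?_, continuous_invFun := ?_ }⟩⟩
  · refine continuous_pi fun I => ?_
    let g := (e I).toAlgHom.comp (Ideal.Quotient.mkₐ k I.1.ideal)
    refine continuous_of_continuousAt_zero g fun s hs => ?_
    rw [mem_map]
    refine mem_of_superset (I.1.isOpen.mem_nhds (zero_mem _)) fun a ha => ?_
    have h0 : g a = 0 := (hf0 a I).2 ha
    rw [Set.mem_preimage, h0, ← map_zero g]
    exact mem_of_mem_nhds hs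
  · refine continuous_of_continuousAt_zero E.symm fun s hs => ?_
    rw [map_zero] at hs
    rw [mem_map]
    obtain ⟨I, hI⟩ := IsPseudocompactAlgebra.exists_openIdeal k A hs
    -- The same finite intersection shows that the inverse is continuous: vanishing in the
    -- coordinates of `S` forces membership in `I`.
    obtain ⟨S, hS⟩ := exists_finset_simple I
    refine mem_of_superset ((isOpen_setOf_forall_eq_zero S).mem_nhds fun _ _ => rfl)
      fun x hx => hI (hS _ fun J hJ => ?_)
    rw [← hf0]
    change E (E.symm x) J = 0
    rw [E.apply_symm_apply]
    exact hx J hJ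

end

theorem mainTheorem3 (k : Type v) (A : Type u) [Field k] [Ring A] [Algebra k A]
    [TopologicalSpace A] [IsPseudocompactAlgebra k A] :
    List.TFAE [
      IsSeparableAlgebra k A,
      IsProductOfSeparableMatrixAlgebras k A,
      IsInverseLimitOfSeparable k A,
      IsProjectiveBimodule k A A,
      ∃ γ : A →L[k] CompletedTensor k A A, IsBimoduleHom A γ ∧ ∀ a, mulMap k A (γ a) = a,
      ∃ p : CompletedTensor k A A, mulMap k A p = 1 ∧ ∀ a : A, a • p = op a • p,
      EveryDerivationInner k A,
      IsInnerDerivation (universalDerivation k A)] := by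
  tfae_have 1 → 6 := fun h => exists_separabilityIdempotent ((isSeparableAlgebra_iff k A).1 h)
  tfae_have 2 → 6 := fun h =>
    exists_separabilityIdempotent (hasSeparabilityIdempotent_quotient_of_isProduct h)
  tfae_have 3 → 6 := fun h =>
    exists_separabilityIdempotent (hasSeparabilityIdempotent_quotient_of_isInverseLimit h)
  tfae_have 6 → 1 := fun h =>
    (isSeparableAlgebra_iff k A).2 (hasSeparabilityIdempotent_quotient_of_exists h)
  tfae_have 6 → 2 := fun h => isProductOfSeparableMatrixAlgebras_of_hasSeparabilityIdempotent
    (hasSeparabilityIdempotent_quotient_of_exists h)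
  tfae_have 6 → 3 := fun h => isInverseLimitOfSeparable_of_hasSeparabilityIdempotent
    (hasSeparabilityIdempotent_quotient_of_exists h)
  tfae_have 6 → 4 := isProjectiveBimodule_of_separabilityIdempotent
  tfae_have 4 → 5 := fun h => exists_section_mulMap_of_isProjectiveBimodule h
    (IsPseudocompactAlgebra.isPseudocompactBimodule k A)
  tfae_have 5 → 6 := exists_separabilityIdempotent_of_section_mulMap
  tfae_have 6 → 7 := everyDerivationInner_of_separabilityIdempotent
  tfae_have 7 → 8 := fun h => h _ (KerMul.isPseudocompactBimodule k A) _
    (isDerivation_universalDerivation k A)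
  tfae_have 8 → 6 := exists_separabilityIdempotent_of_isInnerDerivation
  tfae_finish
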